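/- Consider an $M/M/\infty$ queue with arrival rate $\lambda>0$ and service rate $\mu>0$ of each server, whose entire service capacity can be switched on and off. While the system is on, each customer present is served at rate $\mu$; while it is off, nobody is served. The costs are a holding cost $h>0$ per customer and unit of time, a running cost $c\ge 0$ per unit of time while the system is on, a start-up cost $s_1\ge 0$ for each switching on, and a shut-down cost $s_0\ge 0$ for each switching off, where $s_0+s_1>0$. For an integer $N\ge 1$, let $\psi_N$ be the $(0,N)$-policy: a running system is switched off when it becomes empty, and an idling system is switched on when there are at least $N$ customers. Let $v^{\psi_N}=\limsup_{t\to\infty}t^{-1}E\,C(t)$ be its average cost per unit time, where $C(t)$ is the total (holding, running and switching) cost incurred during $[0,t]$; the initial number of customers and the initial status (on or off) of the servers are arbitrary but fixed. Let $$\tilde N=\min\left\{N\in\mathbb N:\ N\ge \frac ch,\ \frac{N(N+1)}{2\lambda}\ge\frac{s_0+s_1}{h}\right\}.$$ Then, for every $N\ge\tilde N$, we have $v^{\psi_N}<v^{\psi_{N+1}}$, with the single exception of the case when $N=\frac ch$ and $\frac{N(N+1)}{2\lambda}=\frac{s_0+s_1}{h}$ hold simultaneously (which is possible only for $N=\tilde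 N$); in that case $v^{\psi_N}=v^{\psi_{N+1}}$. Consequently, $$\inf_{N\ge 1}v^{\psi_N}=\min_{1\le N\le\tilde N}v^{\psi_N}.$$ -/

import Mathlib

open MeasureTheory ProbabilityTheory Filter
open scoped ENNReal

namespace SwitchQueue

noncomputable section

/-- Data of an `M/M/∞` queue whose entire service capacity can be switched on and off:
arrival rate `lam`, service rate `mu` of each server, holding cost rate `h` per customer,
running cost rate `c`, shut-down cost `s₀` and start-up cost `s₁`. -/
structure Params where
  lam : ℝ
  mu : ℝ
  h : ℝ
  c : ℝ
  s₀ : ℝ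
  s₁ : ℝ

/-- A state `(i, δ)`: the number `i` of customers in the system and the status `δ` of the servers
(`true` is on, `false` is off) just before the last jump. -/
abbrev State := ℕ × Bool

/-- A stationary policy: in state `(i, δ)` it runs the system until the next jump if the
value is `true`, and keeps it off until the next jump if the value is `false`. -/
abbrev Policy := State → Bool

/-- The `(M,N)`-policy: a running system is switched off when there are at most `M` customers,
an idling system is switched on when there are at least `N` customers. -/
def thresholdPolicy (M N : ℕ) : Policy := fun z =>
  if z.2 then decide (M < z.1) else decide (N ≤ z.1)

namespace Params

variable (p : Params)

/-- Rate of departures with `i` customers under action `a`: each of the `i` customers is served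
at rate `mu` if the system is on, and there is no service if it is off. -/
def departureRate (i : ℕ) (a : Bool) : ℝ := if a then i * p.mu else 0

/-- Total jump rate with `i` customers under action `a`. -/
def exitRate (i : ℕ) (a : Bool) : ℝ := p.lam + p.departureRate i a

/-- Cost per unit time with `i` customers under action `a`. -/
def costRate (i : ℕ) (a : Bool) : ℝ := p.h * i + if a then p.c else 0

/-- Instantaneous cost of taking action `a` when the status of the servers is `δ`. -/
def switchCost (δ a : Bool) : ℝ := if a = δ then 0 else if a then p.s₁ else p.s₀

end Params

/-- The randomness that drives the process: for each jump `n`, a unit exponential variable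
`(ω n).1` (for the sojourn time) and a uniform variable `(ω n).2` on `[0,1)` (for the direction
of the jump). -/
abbrev Noise := ℕ → ℝ × ℝ

/-- The law of a standard exponential variable and an independent uniform one on `[0,1)`. -/
def stepLaw : Measure (ℝ × ℝ) := (expMeasure 1).prod (volume.restrict (Set.Ico 0 1))

instance : IsProbabilityMeasure stepLaw := by
  have : IsProbabilityMeasure (expMeasure 1) := isProbabilityMeasure_expMeasure one_pos
  have : IsProbabilityMeasure ((volume : Measure ℝ).restrict (Set.Ico 0 1)) := ⟨by simp⟩
  unfold stepLaw
  infer_instance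

/-- The drivers of the different jumps are independent and identically distributed. -/
def noiseLaw : Measure Noise := Measure.infinitePi fun _ => stepLaw

namespace Params

variable (p : Params) (φ : Policy) (z : State) (ω : Noise)

/-- The embedded jump chain under the stationary policy `φ` from the initial state `z`. In state
`(i, δ)` with action `a = φ (i, δ)`, the next state is `(i + 1, a)` with probability
`lam / exitRate i a` (arrival) and `(i - 1, a)` otherwise (departure). -/
def chain : ℕ → State
  | 0 => z
  | n + 1 =>
    let y := chain n
    let a := φ y
    if (ω n).2 < p.lam / p.exitRate y.1 a then (y.1 + 1, a) else (y.1 - 1, a)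

/-- The time of the `n`-th jump (time `0` for `n = 0`): the sojourn time in the `k`-th state
`(i, δ)` is exponential with intensity `exitRate i (φ (i, δ))`. -/
def jumpTime (n : ℕ) : ℝ :=
  ∑ k ∈ Finset.range n,
    (ω k).1 / p.exitRate (p.chain φ z ω k).1 (φ (p.chain φ z ω k))

/-- The state at time `t`: the state entered at the last jump up to time `t`. -/
def stateAt (t : ℝ) : State := p.chain φ z ω (sSup {n : ℕ | p.jumpTime φ z ω n ≤ t})

/-- The cumulative cost during `[0,t]`: holding and running costs, plus the switching costs
at time `0` and at the jump epochs up to time `t`. -/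
def cumulativeCost (t : ℝ) : ℝ≥0∞ :=
  (∫⁻ s in Set.Icc 0 t,
      ENNReal.ofReal (p.costRate (p.stateAt φ z ω s).1 (φ (p.stateAt φ z ω s)))) +
    ∑' n : ℕ, if p.jumpTime φ z ω n ≤ t then
      ENNReal.ofReal (p.switchCost (p.chain φ z ω n).2 (φ (p.chain φ z ω n))) else 0

/-- The average cost per unit time of the stationary policy `φ` from the initial state `z`:
the upper limit of the expected cumulative cost during `[0,t]` divided by `t`. -/
def averageCost : ℝ≥0∞ :=
  limsup (fun t : ℝ => (∫⁻ ω, p.cumulativeCost φ z ω t ∂noiseLaw) / ENNReal.ofReal t) atTop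

/-- The smallest integer `N ≥ c / h` such that `N (N + 1) / (2 lam) ≥ (s₀ + s₁) / h`. -/
def Ntilde : ℕ :=
  sInf {N : ℕ | p.c / p.h ≤ N ∧ (p.s₀ + p.s₁) / p.h ≤ N * (N + 1) / (2 * p.lam)}

/-- The set in the definition of `Ntilde` is never empty, so `Ntilde` is its least element. -/
theorem isLeast_Ntilde (hlam : 0 < p.lam) :
    IsLeast {N : ℕ | p.c / p.h ≤ N ∧ (p.s₀ + p.s₁) / p.h ≤ N * (N + 1) / (2 * p.lam)}
      p.Ntilde := by
  refine ⟨Nat.sInf_mem ?_, fun N hN => Nat.sInf_le hN⟩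
  obtain ⟨N, hN⟩ := exists_nat_ge (max (p.c / p.h) (max 1 ((p.s₀ + p.s₁) / p.h * (2 * p.lam))))
  rw [max_le_iff, max_le_iff] at hN
  obtain ⟨h1, h2, h3⟩ := hN
  refine ⟨N, h1, ?_⟩
  rw [le_div_iff₀ (by positivity)]
  nlinarith

end Params

end

end SwitchQueue

namespace SwitchQueue

noncomputable section

/-! The average cost of the `(0,N)`-policy has a closed form. Let `S k = descentLoad ρ k` be the
mean number of arrivals while a running queue of load `ρ = lam / mu` goes from `k + 1` to `k`
customers, and let `B N` be the sum of `S k` over `k < N`. A cycle contains `N` arrivals while off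
and `B N` while on, and every customer costs `h / mu` during service. Hence the average cost is `h ρ
+ (lam (s₀ + s₁) + h N (N - 1) / 2 + c B N) / (N + B N)`.

This is not derived from renewal theory. The file exhibits an explicit solution of the Poisson
equation (`isRelativeValue_value`) and shows in `averageCost_eq` that its constant is the average
cost from every initial state. Memorylessness (`lintegral_sojourn`) turns expected time integrals
into sums over completed sojourns, so that Dynkin's formula is a telescoping sum. The relative value
grows linearly in the number of customers, whose second moment is at most linear in time, so the
error is `o(t)`.

The comparison is then algebra (`thresholdCost_succ_sub`): the difference of the costs for `N + 1`
and `N` has the sign of `(1 + S N) (h N (N + 1) / 2 - lam (s₀ + s₁)) + (h N - c) (B N - N S N)`.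
Since `S` is strictly decreasing, `B N > N S N`; the other two brackets are nonnegative exactly
under the two conditions defining `Ntilde`. -/

instance : IsProbabilityMeasure (expMeasure 1) := isProbabilityMeasure_expMeasure one_pos

instance : IsProbabilityMeasure ((volume : Measure ℝ).restrict (Set.Ico 0 1)) := ⟨by simp⟩

instance : IsProbabilityMeasure noiseLaw := by unfold noiseLaw; infer_instance

/-! ### Exponential variables -/

theorem expMeasure_Iic_of_nonpos {b : ℝ} (hb : b ≤ 0) : expMeasure 1 (Set.Iic b) = 0 := by
  have h := cdf_expMeasure_eq one_pos b
  rw [cdf_eq_real, measureReal_def] at h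
  rcases hb.lt_or_eq with hb | rfl
  · rw [if_neg hb.not_ge, ENNReal.toReal_eq_zero_iff] at h
    exact h.resolve_right (measure_ne_top _ _)
  · simp only [le_refl, if_true, mul_zero, neg_zero, Real.exp_zero, sub_self] at h
    rw [ENNReal.toReal_eq_zero_iff] at h
    exact h.resolve_right (measure_ne_top _ _)

theorem expMeasure_Ioi {u : ℝ} (hu : 0 ≤ u) :
    expMeasure 1 (Set.Ioi u) = ENNReal.ofReal (Real.exp (-u)) := by
  have h := cdf_expMeasure_eq one_pos u
  rw [cdf_eq_real, if_pos hu, one_mul] at h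
  have h2 := probReal_compl_eq_one_sub (μ := expMeasure 1) (measurableSet_Iic (a := u))
  rw [Set.compl_Iic, h, sub_sub_cancel] at h2
  rw [← h2, ofReal_measureReal]

/-- The truncated mean of a unit exponential variable equals the truncation probability. -/
theorem lintegral_min_expMeasure (b : ℝ) :
    ∫⁻ e, ENNReal.ofReal (min e b) ∂(expMeasure 1) = expMeasure 1 (Set.Iic b) := by
  rcases lt_or_ge b 0 with hb | hb
  · rw [expMeasure_Iic_of_nonpos hb.le]
    simp [ENNReal.ofReal_of_nonpos, hb.le]
  have hpos : ∀ᵐ e ∂(expMeasure 1), 0 ≤ e := by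
    rw [ae_iff]
    refine measure_mono_null ?_ (expMeasure_Iic_of_nonpos le_rfl)
    intro e he
    simp only [Set.mem_ofPred_eq, not_le] at he
    exact he.le
  -- Layer-cake formula: the mean is the integral of the tail `exp (-u)` over `0 < u < b`, and this
  -- tail coincides with the density.
  rw [lintegral_eq_lintegral_meas_lt _ (by filter_upwards [hpos] with e he; exact le_min he hb)
    (by fun_prop)]
  have h1 : ∀ u ∈ Set.Ioi (0 : ℝ), expMeasure 1 {e | u < min e b} =
      (Set.Iio b).indicator (fun u => ENNReal.ofReal (Real.exp (-u))) u := by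
    intro u hu
    by_cases hub : u < b
    · rw [Set.indicator_of_mem (show u ∈ Set.Iio b from hub), ← expMeasure_Ioi hu.le]
      congr 1; ext e; simp [hub]
    · rw [Set.indicator_of_notMem (by simpa using hub)]
      simp [hub]
  rw [setLIntegral_congr_fun measurableSet_Ioi h1, setLIntegral_indicator measurableSet_Iio]
  have h2 : expMeasure 1 (Set.Iic b) = ∫⁻ x in Set.Iic b, exponentialPDF 1 x := by
    rw [expMeasure, gammaMeasure, withDensity_apply _ measurableSet_Iic]
    rfl
  have h3 : ∫⁻ x in Set.Iio b ∩ Set.Ioi 0, ENNReal.ofReal (Real.exp (-x)) =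
      ∫⁻ x in Set.Iio b ∩ Set.Ioi 0, exponentialPDF 1 x := by
    refine setLIntegral_congr_fun (measurableSet_Iio.inter measurableSet_Ioi) ?_
    intro x hx
    simp only
    rw [exponentialPDF_of_nonneg hx.2.le]
    simp
  rw [h2, h3, setLIntegral_congr (Iio_ae_eq_Iic (a := b)).symm]
  rw [← lintegral_inter_add_sdiff (exponentialPDF 1) (Set.Iio b) (measurableSet_Ioi (a := (0:ℝ)))]
  symm
  convert add_zero _
  have h4 : Set.Iio b \ Set.Ioi 0 ⊆ Set.Iic 0 := by
    intro x hx; simpa using hx.2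
  refine le_antisymm ((lintegral_mono_set h4).trans ?_) zero_le
  rw [setLIntegral_congr (Iio_ae_eq_Iic (a := (0:ℝ))).symm,
    lintegral_exponentialPDF_of_nonpos le_rfl]

/-! ### The embedded chain and its clock -/

namespace Params

variable (p : Params) (φ : Policy)

/-- The total jump rate in a state, under the action prescribed by the policy. -/
def rate (y : State) : ℝ := p.exitRate y.1 (φ y)

/-- The state entered from `y` when the uniform variable takes the value `u`. -/
def next (y : State) (u : ℝ) : State :=
  if u < p.lam / p.rate φ y then (y.1 + 1, φ y) else (y.1 - 1, φ y)

/-- One step of the embedded chain together with the clock. -/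
def clockStep (y : State × ℝ) (x : ℝ × ℝ) : State × ℝ :=
  (p.next φ y.1 x.2, y.2 + x.1 / p.rate φ y.1)

/-- The embedded chain together with the jump time. -/
def clocked (z : State) (n : ℕ) (ω : Noise) : State × ℝ :=
  (p.chain φ z ω n, p.jumpTime φ z ω n)

theorem clocked_zero (z : State) (ω : Noise) : p.clocked φ z 0 ω = (z, 0) := by
  simp [clocked, chain, jumpTime]

theorem clocked_succ (z : State) (n : ℕ) (ω : Noise) :
    p.clocked φ z (n + 1) ω = p.clockStep φ (p.clocked φ z n ω) (ω n) := by
  simp only [clocked, clockStep, chain, next, jumpTime, Finset.sum_range_succ, rate]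
  rfl

theorem jumpTime_succ (z : State) (n : ℕ) (ω : Noise) :
    p.jumpTime φ z ω (n + 1) =
      p.jumpTime φ z ω n + (ω n).1 / p.rate φ (p.chain φ z ω n) := by
  simp only [jumpTime, Finset.sum_range_succ, rate]

theorem chain_succ (z : State) (n : ℕ) (ω : Noise) :
    p.chain φ z ω (n + 1) = p.next φ (p.chain φ z ω n) (ω n).2 := by
  simp only [chain, next, rate]
  rfl

theorem measurable_next : Measurable fun x : State × ℝ => p.next φ x.1 x.2 := by
  refine measurable_from_prod_countable_right fun y => ?_
  exact Measurable.ite (measurableSet_lt measurable_id (measurable_const (a := p.lam / p.rate φ y)))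
    (measurable_const (a := (y.1 + 1, φ y))) (measurable_const (a := (y.1 - 1, φ y)))

theorem measurable_clockStep :
    Measurable fun x : (State × ℝ) × (ℝ × ℝ) => p.clockStep φ x.1 x.2 := by
  refine Measurable.prodMk ?_ ?_
  · exact (p.measurable_next φ).comp
      ((measurable_fst.comp measurable_fst).prodMk (measurable_snd.comp measurable_snd))
  · have : Measurable (p.rate φ) := measurable_of_countable _
    fun_prop

theorem measurable_clocked (z : State) (n : ℕ) : Measurable (p.clocked φ z n) := by
  induction n with
  | zero => simp only [funext (p.clocked_zero φ z)]; exact measurable_const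
  | succ n ih =>
    simp only [funext (p.clocked_succ φ z n)]
    exact (p.measurable_clockStep φ).comp (ih.prodMk (measurable_pi_apply n))

theorem measurable_chain (z : State) (n : ℕ) : Measurable fun ω => p.chain φ z ω n :=
  measurable_fst.comp (p.measurable_clocked φ z n)

theorem measurable_jumpTime (z : State) (n : ℕ) : Measurable fun ω => p.jumpTime φ z ω n :=
  measurable_snd.comp (p.measurable_clocked φ z n)

theorem clocked_congr (z : State) (n : ℕ) {ω ω' : Noise} (h : ∀ k < n, ω k = ω' k) :
    p.clocked φ z n ω = p.clocked φ z n ω' := by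
  induction n with
  | zero => simp [clocked_zero]
  | succ n ih =>
    rw [clocked_succ, clocked_succ, ih fun k hk => h k (by omega), h n (by omega)]

/-- The state and clock at jump `n` depend only on the first `n` drivers, so they factor through the
restriction to `Finset.range n`; `ext` pads a finite sequence with zeros to express this. -/
theorem indepFun_clocked (z : State) (n : ℕ) :
    IndepFun (p.clocked φ z n) (fun ω : Noise => ω n) noiseLaw := by
  have h0 : iIndepFun (fun (i : ℕ) (ω : Noise) => ω i) noiseLaw :=
    iIndepFun_infinitePi (P := fun _ : ℕ => stepLaw) (X := fun _ x => x) fun _ => measurable_id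
  have h1 := h0.indepFun_finset (Finset.range n) {n} (by simp) (fun i => measurable_pi_apply i)
  let ext : (Finset.range n → ℝ × ℝ) → Noise := fun x k =>
    if hk : k ∈ Finset.range n then x ⟨k, hk⟩ else 0
  have hext : Measurable ext := by
    refine measurable_pi_lambda _ fun k => ?_
    by_cases hk : k ∈ Finset.range n
    · simp only [ext, hk, dite_true]; exact measurable_pi_apply _
    · simp only [ext, hk, dite_false]; exact measurable_const
  have hev : Measurable fun x : ({n} : Finset ℕ) → ℝ × ℝ => x ⟨n, Finset.mem_singleton_self n⟩ :=
    measurable_pi_apply _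
  have h2 := h1.comp ((p.measurable_clocked φ z n).comp hext) hev
  have h3 : p.clocked φ z n =
      (p.clocked φ z n ∘ ext) ∘ fun (ω : Noise) (i : Finset.range n) => ω i := by
    funext ω
    refine p.clocked_congr φ z n fun k hk => ?_
    simp [ext, hk]
  rw [h3]
  exact h2

theorem map_clocked_prod (z : State) (n : ℕ) :
    noiseLaw.map (fun ω => (p.clocked φ z n ω, ω n)) =
      (noiseLaw.map (p.clocked φ z n)).prod stepLaw := by
  rw [(p.indepFun_clocked φ z n).map_prod_eq_prod_map_map
    (p.measurable_clocked φ z n).aemeasurable (measurable_pi_apply n).aemeasurable]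
  congr 1
  exact Measure.infinitePi_map_eval _ n

end Params

/-! ### One-step means and memorylessness -/

namespace Params

variable (p : Params) (φ : Policy)

theorem rate_pos (hlam : 0 < p.lam) (hmu : 0 < p.mu) (y : State) : 0 < p.rate φ y := by
  unfold rate exitRate departureRate
  split_ifs <;> positivity

/-- The expected value of `f` after one step of the embedded chain. -/
def stepMean (f : State → ℝ) (y : State) : ℝ :=
  p.lam / p.rate φ y * f (y.1 + 1, φ y) + (1 - p.lam / p.rate φ y) * f (y.1 - 1, φ y)

theorem lam_div_rate_mem (hlam : 0 < p.lam) (hmu : 0 < p.mu) (y : State) :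
    p.lam / p.rate φ y ∈ Set.Icc (0 : ℝ) 1 := by
  have h := p.rate_pos φ hlam hmu y
  refine ⟨by positivity, (div_le_one h).2 ?_⟩
  unfold rate exitRate departureRate
  split_ifs
  · have := mul_nonneg (Nat.cast_nonneg (α := ℝ) y.1) hmu.le
    linarith
  · simp

theorem integral_next (hlam : 0 < p.lam) (hmu : 0 < p.mu) (f : State → ℝ) (y : State) :
    ∫ u in Set.Ico (0 : ℝ) 1, f (p.next φ y u) = p.stepMean φ f y := by
  obtain ⟨h0, h1⟩ := p.lam_div_rate_mem φ hlam hmu y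
  set r := p.lam / p.rate φ y with hr
  have hI : IntegrableOn (fun u => f (p.next φ y u)) (Set.Ico (0 : ℝ) 1) := by
    have h2 : Measurable fun u => f (p.next φ y u) :=
      (measurable_of_countable f).comp ((p.measurable_next φ).comp measurable_prodMk_left)
    refine Integrable.of_bound h2.aestronglyMeasurable
      (max |f (y.1 + 1, φ y)| |f (y.1 - 1, φ y)|) (ae_of_all _ fun u => ?_)
    unfold next
    split_ifs
    · exact le_max_left _ _
    · exact le_max_right _ _
  rw [← Set.Ico_union_Ico_eq_Ico h0 h1, setIntegral_union (Set.Ico_disjoint_Ico_same)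
    measurableSet_Ico (hI.mono_set (Set.Ico_subset_Ico_right h1))
    (hI.mono_set (Set.Ico_subset_Ico_left h0))]
  have hup : ∀ u ∈ Set.Ico 0 r, f (p.next φ y u) = f (y.1 + 1, φ y) := fun u hu => by
    simp only [next, ← hr, if_pos hu.2]
  have hdown : ∀ u ∈ Set.Ico r 1, f (p.next φ y u) = f (y.1 - 1, φ y) := fun u hu => by
    simp only [next, ← hr, if_neg hu.1.not_gt]
  rw [setIntegral_congr_fun measurableSet_Ico hup, setIntegral_congr_fun measurableSet_Ico hdown]
  simp [stepMean, ← hr, h0, h1]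

theorem chain_fst_le (z : State) (n : ℕ) (ω : Noise) :
    (p.chain φ z ω n).1 ≤ z.1 + n := by
  induction n with
  | zero => simp [chain]
  | succ n ih =>
    rw [chain_succ, next]
    split_ifs <;> simp only <;> omega

theorem exists_bound_chain (f : State → ℝ) (z : State) (n : ℕ) :
    ∃ C, ∀ ω, |f (p.chain φ z ω n)| ≤ C := by
  let s : Finset State := Finset.range (z.1 + n + 1) ×ˢ Finset.univ
  refine ⟨∑ y ∈ s, |f y|, fun ω => ?_⟩
  refine Finset.single_le_sum (f := fun y => |f y|) (fun _ _ => abs_nonneg _) ?_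
  have := p.chain_fst_le φ z n ω
  simp [s]; omega

theorem integrable_chain (f : State → ℝ) (z : State) (n : ℕ) :
    Integrable (fun ω => f (p.chain φ z ω n)) noiseLaw := by
  obtain ⟨C, hC⟩ := p.exists_bound_chain φ f z n
  exact Integrable.of_bound
    ((measurable_of_countable f).comp (p.measurable_chain φ z n)).aestronglyMeasurable C
    (ae_of_all _ hC)

/-- Given the chain and the clock up to the `n`-th jump, the direction of the next jump is
independent of the sojourn time. -/
theorem setIntegral_chain_succ (hlam : 0 < p.lam) (hmu : 0 < p.mu) (z : State) (n : ℕ) (t : ℝ)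
    (f : State → ℝ) :
    ∫ ω in {ω | p.jumpTime φ z ω (n + 1) ≤ t}, f (p.chain φ z ω (n + 1)) ∂noiseLaw =
      ∫ ω in {ω | p.jumpTime φ z ω (n + 1) ≤ t}, p.stepMean φ f (p.chain φ z ω n)
        ∂noiseLaw := by
  have hmeas : MeasurableSet {ω | p.jumpTime φ z ω (n + 1) ≤ t} :=
    measurableSet_le (p.measurable_jumpTime φ z _) measurable_const
  have hY : Measurable fun ω : Noise => (p.clocked φ z n ω, ω n) :=
    (p.measurable_clocked φ z n).prodMk (measurable_pi_apply n)
  have hr : Measurable (p.rate φ) := measurable_of_countable _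
  -- Given the past, the event depends on the exponential variable only and `k` on the uniform one
  -- only, so the integral factors. Both sides of the claim have this form with the same integral
  -- over the uniform variable.
  have key : ∀ k : State × ℝ → ℝ, Measurable k →
      Integrable (fun ω : Noise => k (p.chain φ z ω n, (ω n).2)) noiseLaw →
      ∫ ω in {ω | p.jumpTime φ z ω (n + 1) ≤ t}, k (p.chain φ z ω n, (ω n).2) ∂noiseLaw =
      ∫ y, (∫ e, (Set.Iic t).indicator 1 (y.2 + e / p.rate φ y.1) ∂expMeasure 1) *
        (∫ u in Set.Ico (0 : ℝ) 1, k (y.1, u)) ∂(noiseLaw.map (p.clocked φ z n)) := by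
    intro k hk hint
    let G : (State × ℝ) × (ℝ × ℝ) → ℝ := fun x =>
      (Set.Iic t).indicator 1 (x.1.2 + x.2.1 / p.rate φ x.1.1) * k (x.1.1, x.2.2)
    have hG : Measurable G := by
      refine Measurable.mul ?_ (by fun_prop)
      exact (measurable_one.indicator measurableSet_Iic).comp (by fun_prop)
    have hGω : (fun ω => G (p.clocked φ z n ω, ω n)) =
        {ω | p.jumpTime φ z ω (n + 1) ≤ t}.indicator
          (fun ω => k (p.chain φ z ω n, (ω n).2)) := by
      funext ω
      simp only [G, clocked, Set.indicator_apply, Set.mem_ofPred_eq, jumpTime_succ, Set.mem_Iic,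
        Pi.one_apply, ite_mul, one_mul, zero_mul]
    have hGint : Integrable G ((noiseLaw.map (p.clocked φ z n)).prod stepLaw) := by
      rw [← map_clocked_prod, integrable_map_measure hG.aestronglyMeasurable hY.aemeasurable]
      change Integrable (fun ω => G (p.clocked φ z n ω, ω n)) noiseLaw
      rw [hGω]
      exact hint.indicator hmeas
    rw [← integral_indicator hmeas, ← hGω, ← integral_map hY.aemeasurable (f := G)
      hG.aestronglyMeasurable, map_clocked_prod, integral_prod _ hGint]
    refine integral_congr_ae (ae_of_all _ fun y => ?_)
    simp only [G, stepLaw]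
    exact integral_prod_mul (fun e => (Set.Iic t).indicator 1 (y.2 + e / p.rate φ y.1))
      (fun u => k (y.1, u))
  have hf : Measurable f := measurable_of_countable f
  have hm : Measurable (p.stepMean φ f) := measurable_of_countable _
  have hint := p.integrable_chain φ f z (n + 1)
  simp only [chain_succ] at hint ⊢
  rw [key (fun x => f (p.next φ x.1 x.2)) (hf.comp (p.measurable_next φ)) hint,
    key (fun x => p.stepMean φ f x.1) (by fun_prop) (p.integrable_chain φ _ z n)]
  simp only [p.integral_next φ hlam hmu]
  simp

/-- Memorylessness: the expected time spent in the `n`-th state before time `t` is the expected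
sojourn time restricted to the event that this sojourn ends before time `t`. -/
theorem lintegral_sojourn (hlam : 0 < p.lam) (hmu : 0 < p.mu) (z : State) (n : ℕ) (t : ℝ)
    (F : State → ℝ≥0∞) :
    ∫⁻ ω, F (p.chain φ z ω n) *
        ENNReal.ofReal (min (p.jumpTime φ z ω (n + 1)) t - p.jumpTime φ z ω n) ∂noiseLaw =
      ∫⁻ ω in {ω | p.jumpTime φ z ω (n + 1) ≤ t},
        F (p.chain φ z ω n) * ENNReal.ofReal (p.rate φ (p.chain φ z ω n))⁻¹ ∂noiseLaw := by
  have hmeas : MeasurableSet {ω | p.jumpTime φ z ω (n + 1) ≤ t} :=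
    measurableSet_le (p.measurable_jumpTime φ z _) measurable_const
  have hY : Measurable fun ω : Noise => (p.clocked φ z n ω, ω n) :=
    (p.measurable_clocked φ z n).prodMk (measurable_pi_apply n)
  have hr : Measurable (p.rate φ) := measurable_of_countable _
  have hF : Measurable F := measurable_of_countable _
  have key : ∀ k : (State × ℝ) × ℝ → ℝ≥0∞, Measurable k →
      ∫⁻ ω, k (p.clocked φ z n ω, (ω n).1) ∂noiseLaw =
      ∫⁻ y, ∫⁻ e, k (y, e) ∂expMeasure 1 ∂(noiseLaw.map (p.clocked φ z n)) := by
    intro k hk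
    rw [← lintegral_map (f := fun x : (State × ℝ) × (ℝ × ℝ) => k (x.1, x.2.1)) (by fun_prop) hY,
      map_clocked_prod, lintegral_prod _ (by fun_prop)]
    refine lintegral_congr fun y => ?_
    rw [stepLaw, lintegral_prod _ (by fun_prop)]
    simp
  rw [← lintegral_indicator hmeas]
  let k₁ : (State × ℝ) × ℝ → ℝ≥0∞ := fun x => F x.1.1 *
    ENNReal.ofReal (min (x.1.2 + x.2 / p.rate φ x.1.1) t - x.1.2)
  let k₂ : (State × ℝ) × ℝ → ℝ≥0∞ := fun x => F x.1.1 * ENNReal.ofReal (p.rate φ x.1.1)⁻¹ *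
    (Set.Iic t).indicator 1 (x.1.2 + x.2 / p.rate φ x.1.1)
  have hk₁ : Measurable k₁ := by fun_prop
  have hk₂ : Measurable k₂ := by
    refine Measurable.mul (by fun_prop) ?_
    exact (measurable_one.indicator measurableSet_Iic).comp (by fun_prop)
  have e₁ := key k₁ hk₁
  have e₂ := key k₂ hk₂
  simp only [k₁, clocked] at e₁
  simp only [jumpTime_succ]
  rw [e₁]
  have h2 : ∀ ω, k₂ (p.clocked φ z n ω, (ω n).1) =
      {ω | p.jumpTime φ z ω n + (ω n).1 / p.rate φ (p.chain φ z ω n) ≤ t}.indicator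
        (fun ω => F (p.chain φ z ω n) * ENNReal.ofReal (p.rate φ (p.chain φ z ω n))⁻¹) ω := by
    intro ω
    simp only [k₂, clocked, Set.indicator_apply, Set.mem_ofPred_eq, Set.mem_Iic,
      Pi.one_apply, mul_ite, mul_one, mul_zero]
  simp only [← h2]
  rw [e₂]
  refine lintegral_congr fun y => ?_
  have hq := p.rate_pos φ hlam hmu y.1
  set q := p.rate φ y.1
  -- Rescaling time by `q` reduces both sides to a unit exponential cut at `q * (t - y.2)`, where
  -- truncated mean and probability agree. A clock already past `t` gives a negative cut and
  -- contributes zero.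
  have h3 : ∀ e : ℝ, ENNReal.ofReal (min (y.2 + e / q) t - y.2) =
      ENNReal.ofReal q⁻¹ * ENNReal.ofReal (min e (q * (t - y.2))) := by
    intro e
    rw [← ENNReal.ofReal_mul (by positivity), mul_min_of_nonneg _ _ (by positivity),
      ← min_sub_sub_right]
    congr 2
    · field_simp; ring
    · field_simp
  have h4 : ∀ e : ℝ, (Set.Iic t).indicator (1 : ℝ → ℝ≥0∞) (y.2 + e / q) =
      (Set.Iic (q * (t - y.2))).indicator 1 e := by
    intro e
    simp only [Set.indicator_apply, Set.mem_Iic, Pi.one_apply]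
    congr 1
    rw [← le_sub_iff_add_le', div_le_iff₀ hq, mul_comm]
  simp only [k₂]
  rw [show p.rate φ y.1 = q from rfl]
  simp only [h3, h4]
  rw [lintegral_const_mul _ (by fun_prop), lintegral_const_mul _ (by fun_prop),
    lintegral_const_mul _ (measurable_one.indicator measurableSet_Iic),
    lintegral_min_expMeasure, lintegral_indicator_one measurableSet_Iic, mul_assoc]

end Params

/-! ### Splitting time at the jumps -/

theorem ae_noise_nonneg : ∀ᵐ ω ∂noiseLaw, ∀ k, 0 ≤ (ω k).1 := by
  rw [ae_all_iff]
  intro k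
  have h1 : MeasurePreserving (fun ω : Noise => ω k) noiseLaw stepLaw :=
    measurePreserving_eval_infinitePi (fun _ : ℕ => stepLaw) k
  have h2 : MeasurePreserving (Prod.fst : ℝ × ℝ → ℝ) stepLaw (expMeasure 1) :=
    measurePreserving_fst
  refine (h2.comp h1).quasiMeasurePreserving.ae (p := fun e => 0 ≤ e) ?_
  rw [ae_iff]
  refine measure_mono_null ?_ (expMeasure_Iic_of_nonpos le_rfl)
  intro e he
  simp only [Set.mem_ofPred_eq, not_le] at he
  exact he.le

theorem sum_ofReal_min_sub_le {τ : ℕ → ℝ} (hτ : Monotone τ) (h0 : τ 0 = 0) (t : ℝ) (n : ℕ) :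
    ∑ k ∈ Finset.range n, ENNReal.ofReal (min (τ (k + 1)) t - τ k) ≤ ENNReal.ofReal t := by
  -- The sharper bound `min (τ n) t` is what the induction on `n` preserves.
  refine le_trans (b := ENNReal.ofReal (min (τ n) t)) ?_
    (ENNReal.ofReal_le_ofReal (min_le_right _ _))
  induction n with
  | zero => simp
  | succ n ih =>
    rw [Finset.sum_range_succ]
    refine (add_le_add_left ih _).trans ?_
    have h1 : 0 ≤ τ n := h0 ▸ hτ (Nat.zero_le n)
    have h2 : τ n ≤ τ (n + 1) := hτ n.le_succ
    rcases le_or_gt (τ n) t with h | h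
    · rw [min_eq_left h, ← ENNReal.ofReal_add h1 (sub_nonneg.2 (le_min h2 h))]
      exact ENNReal.ofReal_le_ofReal (by linarith)
    · rw [ENNReal.ofReal_of_nonpos (p := min (τ (n + 1)) t - τ n)
        (by linarith [min_le_right (τ (n + 1)) t]), add_zero, min_eq_right h.le,
        min_eq_right (h.le.trans h2)]

/-- The integral over `[0,t]` of a function of the number of points of `τ` up to the current time,
split at the points of `τ`. -/
theorem lintegral_comp_sSup {τ : ℕ → ℝ} (hτ : Monotone τ) (h0 : τ 0 = 0) {t : ℝ}
    (hex : ∃ n, t < τ n) (F : ℕ → ℝ≥0∞) :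
    ∫⁻ s in Set.Icc 0 t, F (sSup {n : ℕ | τ n ≤ s}) =
      ∑' n, F n * ENNReal.ofReal (min (τ (n + 1)) t - τ n) := by
  have hnn : ∀ n, 0 ≤ τ n := fun n => h0 ▸ hτ (Nat.zero_le n)
  have hsup : ∀ n, ∀ s ∈ Set.Ico (τ n) (τ (n + 1)), sSup {n : ℕ | τ n ≤ s} = n := by
    intro n s hs
    have : {n : ℕ | τ n ≤ s} = Set.Iic n := by
      ext k
      simp only [Set.mem_ofPred_eq, Set.mem_Iic]
      refine ⟨fun hk => ?_, fun hk => (hτ hk).trans hs.1⟩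
      by_contra hlt
      exact absurd (hs.2.trans_le ((hτ (by omega : n + 1 ≤ k)).trans hk)) (lt_irrefl _)
    rw [this, csSup_Iic]
  -- `hex` excludes infinitely many points before `t`, in which case the intervals might not cover
  -- and `sSup` would take its default value `0`.
  have hunion : Set.Ico 0 t = ⋃ n, Set.Ico (τ n) (min (τ (n + 1)) t) := by
    ext s
    simp only [Set.mem_Ico, Set.mem_iUnion, lt_min_iff]
    constructor
    · rintro ⟨hs0, hst⟩
      obtain ⟨m, hm⟩ := hex
      have hP : ∃ n, s < τ n := ⟨m, hst.trans hm⟩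
      obtain ⟨k, hk⟩ : ∃ k, Nat.find hP = k + 1 := by
        refine Nat.exists_eq_succ_of_ne_zero fun h => ?_
        have := Nat.find_spec hP
        rw [h, h0] at this
        linarith
      refine ⟨k, ?_, ?_, hst⟩
      · exact not_lt.1 (Nat.find_min hP (m := k) (by omega))
      · rw [← hk]; exact Nat.find_spec hP
    · rintro ⟨n, h1, -, h3⟩
      exact ⟨(hnn n).trans h1, h3⟩
  have hdisj : Pairwise (Function.onFun Disjoint
      fun n => Set.Ico (τ n) (min (τ (n + 1)) t)) := by
    intro i j hij
    refine Set.disjoint_left.2 fun s hi hj => hij ?_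
    rw [← hsup i s ⟨hi.1, hi.2.trans_le (min_le_left _ _)⟩,
      hsup j s ⟨hj.1, hj.2.trans_le (min_le_left _ _)⟩]
  rw [setLIntegral_congr Ico_ae_eq_Icc.symm, hunion,
    lintegral_iUnion (fun _ => measurableSet_Ico) hdisj]
  refine tsum_congr fun n => ?_
  have hconst : ∀ s ∈ Set.Ico (τ n) (min (τ (n + 1)) t), F (sSup {n : ℕ | τ n ≤ s}) = F n :=
    fun s hs => by rw [hsup n s ⟨hs.1, hs.2.trans_le (min_le_left _ _)⟩]
  rw [setLIntegral_congr_fun measurableSet_Ico hconst]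
  simp

/-! ### Dynkin's formula and moment bounds -/

namespace Params

variable (p : Params) (φ : Policy)

theorem jumpTime_zero (z : State) (ω : Noise) : p.jumpTime φ z ω 0 = 0 := by
  simp [jumpTime]

theorem monotone_jumpTime (hlam : 0 < p.lam) (hmu : 0 < p.mu) (z : State) {ω : Noise}
    (hω : ∀ k, 0 ≤ (ω k).1) : Monotone (p.jumpTime φ z ω) := by
  refine monotone_nat_of_le_succ fun n => ?_
  rw [jumpTime_succ]
  have := div_nonneg (hω n) (p.rate_pos φ hlam hmu (p.chain φ z ω n)).le
  linarith

theorem measurableSet_jumpTime_le (z : State) (t : ℝ) (n : ℕ) :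
    MeasurableSet {ω | p.jumpTime φ z ω n ≤ t} :=
  measurableSet_le (p.measurable_jumpTime φ z n) measurable_const

/-- The law of the `n`-th state of the chain on the event that it is entered by time `t`. -/
def entered (z : State) (t : ℝ) (n : ℕ) : Measure State :=
  (noiseLaw.restrict {ω | p.jumpTime φ z ω n ≤ t}).map fun ω => p.chain φ z ω n

/-- The law of the `n`-th state of the chain on the event that it is left by time `t`. -/
def exited (z : State) (t : ℝ) (n : ℕ) : Measure State :=
  (noiseLaw.restrict {ω | p.jumpTime φ z ω (n + 1) ≤ t}).map fun ω => p.chain φ z ω n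

instance (z : State) (t : ℝ) (n : ℕ) : IsFiniteMeasure (p.entered φ z t n) := by
  unfold entered; infer_instance

instance (z : State) (t : ℝ) (n : ℕ) : IsFiniteMeasure (p.exited φ z t n) := by
  unfold exited; infer_instance

variable {p φ}

theorem integrable_entered (f : State → ℝ) {z : State} {t : ℝ} {n : ℕ} :
    Integrable f (p.entered φ z t n) := by
  rw [entered, integrable_map_measure (measurable_of_countable f).aestronglyMeasurable
    (p.measurable_chain φ z n).aemeasurable]
  exact (p.integrable_chain φ f z n).restrict

theorem integrable_exited (f : State → ℝ) {z : State} {t : ℝ} {n : ℕ} :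
    Integrable f (p.exited φ z t n) := by
  rw [exited, integrable_map_measure (measurable_of_countable f).aestronglyMeasurable
    (p.measurable_chain φ z n).aemeasurable]
  exact (p.integrable_chain φ f z n).restrict

theorem integral_entered (f : State → ℝ) {z : State} {t : ℝ} {n : ℕ} :
    ∫ y, f y ∂p.entered φ z t n =
      ∫ ω in {ω | p.jumpTime φ z ω n ≤ t}, f (p.chain φ z ω n) ∂noiseLaw :=
  integral_map (p.measurable_chain φ z n).aemeasurable
    (measurable_of_countable f).aestronglyMeasurable

theorem integral_exited (f : State → ℝ) {z : State} {t : ℝ} {n : ℕ} :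
    ∫ y, f y ∂p.exited φ z t n =
      ∫ ω in {ω | p.jumpTime φ z ω (n + 1) ≤ t}, f (p.chain φ z ω n) ∂noiseLaw :=
  integral_map (p.measurable_chain φ z n).aemeasurable
    (measurable_of_countable f).aestronglyMeasurable

theorem integral_entered_succ (hlam : 0 < p.lam) (hmu : 0 < p.mu) (z : State) (t : ℝ) (n : ℕ)
    (f : State → ℝ) :
    ∫ y, f y ∂p.entered φ z t (n + 1) = ∫ y, p.stepMean φ f y ∂p.exited φ z t n := by
  rw [integral_entered, integral_exited, setIntegral_chain_succ p φ hlam hmu]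

theorem integral_entered_zero (z : State) {t : ℝ} (ht : 0 ≤ t) (f : State → ℝ) :
    ∫ y, f y ∂p.entered φ z t 0 = f z := by
  rw [integral_entered]
  simp [jumpTime_zero, ht, chain]

theorem exited_le_entered (hlam : 0 < p.lam) (hmu : 0 < p.mu) (z : State) (t : ℝ) (n : ℕ) :
    p.exited φ z t n ≤ p.entered φ z t n := by
  refine Measure.map_mono_of_aemeasurable ?_ (p.measurable_chain φ z n).aemeasurable
  refine Measure.restrict_mono_ae ?_
  filter_upwards [ae_noise_nonneg] with ω hω h
  exact ((p.monotone_jumpTime φ hlam hmu z hω) n.le_succ).trans h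

theorem integral_exited_le (hlam : 0 < p.lam) (hmu : 0 < p.mu) (z : State) (t : ℝ) (n : ℕ)
    {f : State → ℝ} (hf : ∀ y, 0 ≤ f y) :
    ∫ y, f y ∂p.exited φ z t n ≤ ∫ y, f y ∂p.entered φ z t n :=
  integral_mono_measure (exited_le_entered hlam hmu z t n) (ae_of_all _ hf)
    (integrable_entered f)

variable (p φ)

/-- The expected value of `f` at the state occupied at time `t` or at the `n`-th jump, whichever
comes first. -/
def stoppedMean (z : State) (t : ℝ) (n : ℕ) (f : State → ℝ) : ℝ :=
  ∑ k ∈ Finset.range n, (∫ y, f y ∂p.entered φ z t k - ∫ y, f y ∂p.exited φ z t k) +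
    ∫ y, f y ∂p.entered φ z t n

/-- The expected length of the time interval up to time `t` or the `n`-th jump. -/
def stoppedTime (z : State) (t : ℝ) (n : ℕ) : ℝ :=
  ∑ k ∈ Finset.range n, ∫ y, (p.rate φ y)⁻¹ ∂p.exited φ z t k

variable {p φ}

/-- Dynkin's formula. -/
theorem stoppedMean_eq (hlam : 0 < p.lam) (hmu : 0 < p.mu) (z : State) {t : ℝ} (ht : 0 ≤ t)
    (n : ℕ) (f : State → ℝ) :
    p.stoppedMean φ z t n f =
      f z + ∑ k ∈ Finset.range n, ∫ y, (p.stepMean φ f y - f y) ∂p.exited φ z t k := by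
  induction n with
  | zero => simp [stoppedMean, integral_entered_zero z ht]
  | succ n ih =>
    rw [Finset.sum_range_succ, ← add_assoc, ← ih, integral_sub (integrable_exited _)
      (integrable_exited _), stoppedMean, stoppedMean, Finset.sum_range_succ,
      integral_entered_succ hlam hmu]
    ring

/-- Each difference of an entered and an exited integral is a positive functional, because `exited`
is dominated by `entered`. -/
theorem stoppedMean_mono (hlam : 0 < p.lam) (hmu : 0 < p.mu) (z : State) (t : ℝ)
    (n : ℕ) {f g : State → ℝ} (hfg : ∀ y, f y ≤ g y) :
    p.stoppedMean φ z t n f ≤ p.stoppedMean φ z t n g := by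
  refine add_le_add (Finset.sum_le_sum fun k _ => ?_)
    (integral_mono (integrable_entered f) (integrable_entered g) hfg)
  have h := integral_exited_le (φ := φ) hlam hmu z t k (f := fun y => g y - f y)
    fun y => sub_nonneg.2 (hfg y)
  rw [integral_sub (integrable_exited _) (integrable_exited _),
    integral_sub (integrable_entered _) (integrable_entered _)] at h
  linarith

theorem stoppedMean_add (z : State) (t : ℝ) (n : ℕ) (f g : State → ℝ) :
    p.stoppedMean φ z t n (fun y => f y + g y) =
      p.stoppedMean φ z t n f + p.stoppedMean φ z t n g := by
  simp only [stoppedMean, integral_add (integrable_entered _) (integrable_entered _),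
    integral_add (integrable_exited _) (integrable_exited _)]
  rw [add_add_add_comm, ← Finset.sum_add_distrib]
  congr 1
  exact Finset.sum_congr rfl fun _ _ => by ring

theorem stoppedMean_const_mul (z : State) (t : ℝ) (n : ℕ) (c : ℝ) (f : State → ℝ) :
    p.stoppedMean φ z t n (fun y => c * f y) = c * p.stoppedMean φ z t n f := by
  simp only [stoppedMean, integral_const_mul]
  rw [mul_add, Finset.mul_sum]
  congr 1
  exact Finset.sum_congr rfl fun _ _ => by ring

theorem stoppedMean_const (hlam : 0 < p.lam) (hmu : 0 < p.mu) (z : State) {t : ℝ} (ht : 0 ≤ t)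
    (n : ℕ) (c : ℝ) : p.stoppedMean φ z t n (fun _ => c) = c := by
  rw [stoppedMean_eq hlam hmu z ht]
  have : ∀ y, p.stepMean φ (fun _ => c) y - c = 0 := fun y => by simp only [stepMean]; ring
  simp [this]

theorem lintegral_exited (F : State → ℝ≥0∞) {z : State} {t : ℝ} {n : ℕ} :
    ∫⁻ y, F y ∂p.exited φ z t n =
      ∫⁻ ω in {ω | p.jumpTime φ z ω (n + 1) ≤ t}, F (p.chain φ z ω n) ∂noiseLaw :=
  lintegral_map (measurable_of_countable F) (p.measurable_chain φ z n)

theorem lintegral_entered (F : State → ℝ≥0∞) {z : State} {t : ℝ} {n : ℕ} :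
    ∫⁻ y, F y ∂p.entered φ z t n =
      ∫⁻ ω in {ω | p.jumpTime φ z ω n ≤ t}, F (p.chain φ z ω n) ∂noiseLaw :=
  lintegral_map (measurable_of_countable F) (p.measurable_chain φ z n)

theorem ofReal_integral_exited {z : State} {t : ℝ} {n : ℕ} {f : State → ℝ} (hf : ∀ y, 0 ≤ f y) :
    ENNReal.ofReal (∫ y, f y ∂p.exited φ z t n) =
      ∫⁻ ω in {ω | p.jumpTime φ z ω (n + 1) ≤ t}, ENNReal.ofReal (f (p.chain φ z ω n))
        ∂noiseLaw := by
  rw [ofReal_integral_eq_lintegral_ofReal (integrable_exited f) (ae_of_all _ hf),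
    lintegral_exited fun y => ENNReal.ofReal (f y)]

theorem ofReal_integral_entered {z : State} {t : ℝ} {n : ℕ} {f : State → ℝ}
    (hf : ∀ y, 0 ≤ f y) :
    ENNReal.ofReal (∫ y, f y ∂p.entered φ z t n) =
      ∫⁻ ω in {ω | p.jumpTime φ z ω n ≤ t}, ENNReal.ofReal (f (p.chain φ z ω n))
        ∂noiseLaw := by
  rw [ofReal_integral_eq_lintegral_ofReal (integrable_entered f) (ae_of_all _ hf),
    lintegral_entered fun y => ENNReal.ofReal (f y)]

/-- The expected reward earned in the `n`-th state by time `t`. -/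
theorem lintegral_reward (hlam : 0 < p.lam) (hmu : 0 < p.mu) (z : State) (t : ℝ) (n : ℕ)
    {f : State → ℝ} (hf : ∀ y, 0 ≤ f y) :
    ∫⁻ ω, ENNReal.ofReal (f (p.chain φ z ω n)) *
        ENNReal.ofReal (min (p.jumpTime φ z ω (n + 1)) t - p.jumpTime φ z ω n) ∂noiseLaw =
      ENNReal.ofReal (∫ y, f y / p.rate φ y ∂p.exited φ z t n) := by
  rw [lintegral_sojourn p φ hlam hmu z n t fun y => ENNReal.ofReal (f y),
    ofReal_integral_exited fun y => div_nonneg (hf y) (p.rate_pos φ hlam hmu y).le]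
  simp only [div_eq_mul_inv, ENNReal.ofReal_mul (hf _)]

theorem stoppedTime_nonneg (hlam : 0 < p.lam) (hmu : 0 < p.mu) (z : State) (t : ℝ) (n : ℕ) :
    0 ≤ p.stoppedTime φ z t n :=
  Finset.sum_nonneg fun _ _ => integral_nonneg fun y => (inv_pos.2 (p.rate_pos φ hlam hmu y)).le

theorem ofReal_integral_inv_rate (hlam : 0 < p.lam) (hmu : 0 < p.mu) (z : State) (t : ℝ)
    (n : ℕ) :
    ENNReal.ofReal (∫ y, (p.rate φ y)⁻¹ ∂p.exited φ z t n) =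
      ∫⁻ ω, ENNReal.ofReal (min (p.jumpTime φ z ω (n + 1)) t - p.jumpTime φ z ω n)
        ∂noiseLaw := by
  have := lintegral_reward (φ := φ) hlam hmu z t n (f := fun _ => 1) fun _ => zero_le_one
  simpa using this.symm

theorem measurable_sojourn (z : State) (t : ℝ) (n : ℕ) : Measurable fun ω =>
    ENNReal.ofReal (min (p.jumpTime φ z ω (n + 1)) t - p.jumpTime φ z ω n) :=
  (((p.measurable_jumpTime φ z _).min measurable_const).sub
    (p.measurable_jumpTime φ z _)).ennreal_ofReal

/-- By memorylessness the summands are the mean sojourn times truncated at `t`, and these add up to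
at most `t` on every path with nonnegative sojourns. -/
theorem stoppedTime_le (hlam : 0 < p.lam) (hmu : 0 < p.mu) (z : State) {t : ℝ} (ht : 0 ≤ t)
    (n : ℕ) : p.stoppedTime φ z t n ≤ t := by
  rw [← ENNReal.ofReal_le_ofReal_iff ht, stoppedTime, ENNReal.ofReal_sum_of_nonneg fun _ _ =>
    integral_nonneg fun y => (inv_pos.2 (p.rate_pos φ hlam hmu y)).le]
  simp only [ofReal_integral_inv_rate hlam hmu]
  rw [← lintegral_finsetSum _ fun k _ => measurable_sojourn z t k]
  calc _ ≤ ∫⁻ _, ENNReal.ofReal t ∂noiseLaw := by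
        refine lintegral_mono_ae ?_
        filter_upwards [ae_noise_nonneg] with ω hω
        exact sum_ofReal_min_sub_le (p.monotone_jumpTime φ hlam hmu z hω)
          (p.jumpTime_zero φ z ω) t n
    _ = ENNReal.ofReal t := by simp

/-- The increment of the one-step mean is the generator divided by the jump rate. -/
theorem stepMean_sub (hlam : 0 < p.lam) (hmu : 0 < p.mu) (f : State → ℝ) (y : State) :
    p.stepMean φ f y - f y = (p.lam * (f (y.1 + 1, φ y) - f y) +
      p.departureRate y.1 (φ y) * (f (y.1 - 1, φ y) - f y)) / p.rate φ y := by
  have hq := p.rate_pos φ hlam hmu y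
  have h : p.departureRate y.1 (φ y) = p.rate φ y - p.lam := by simp [rate, exitRate]
  rw [h, stepMean]
  field_simp
  ring

theorem stepMean_fst_sub (hlam : 0 < p.lam) (hmu : 0 < p.mu) (y : State) :
    p.stepMean φ (fun y => (y.1 : ℝ)) y - y.1 =
      (p.lam - p.departureRate y.1 (φ y)) / p.rate φ y := by
  rw [stepMean_sub hlam hmu]
  -- In the empty state the truncated subtraction `0 - 1 = 0` is harmless: the departure rate
  -- vanishes.
  rcases y with ⟨_ | i, b⟩
  · simp [departureRate]
  · congr 1
    simp
    ring

/-- The expected number of jumps up to time `t` is finite. -/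
theorem sum_exited_univ_le (hlam : 0 < p.lam) (hmu : 0 < p.mu) (z : State) {t : ℝ} (ht : 0 ≤ t)
    (n : ℕ) :
    ∑ k ∈ Finset.range n, ∫ _, (1 : ℝ) ∂p.exited φ z t k ≤ z.1 + 2 * p.lam * t := by
  have h1 := stoppedMean_eq (φ := φ) hlam hmu z ht n fun y => (y.1 : ℝ)
  have h2 : 0 ≤ p.stoppedMean φ z t n fun y => (y.1 : ℝ) := by
    rw [← stoppedMean_const (φ := φ) hlam hmu z ht n 0]
    exact stoppedMean_mono hlam hmu z t n fun y => Nat.cast_nonneg _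
  -- Since departures have rate `rate - lam`, the drift per jump is `2 * lam / rate - 1`. As the
  -- number of customers stays nonnegative, Dynkin's formula bounds the mean number of jumps.
  have h3 : ∀ y : State, p.stepMean φ (fun y => (y.1 : ℝ)) y - y.1 =
      2 * p.lam * (p.rate φ y)⁻¹ - 1 := by
    intro y
    have hq := p.rate_pos φ hlam hmu y
    rw [stepMean_fst_sub hlam hmu,
      show p.departureRate y.1 (φ y) = p.rate φ y - p.lam by simp [rate, exitRate]]
    field_simp
    ring
  simp only [h3] at h1
  have h4 : ∀ k, ∫ y, (2 * p.lam * (p.rate φ y)⁻¹ - 1) ∂p.exited φ z t k =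
      2 * p.lam * ∫ y, (p.rate φ y)⁻¹ ∂p.exited φ z t k - ∫ _, (1 : ℝ) ∂p.exited φ z t k := by
    intro k
    rw [integral_sub (integrable_exited _) (integrable_exited _), integral_const_mul]
  simp only [h4] at h1
  rw [Finset.sum_sub_distrib, ← Finset.mul_sum] at h1
  have h5 := stoppedTime_le (φ := φ) hlam hmu z ht n
  rw [stoppedTime] at h5
  have h6 := mul_le_mul_of_nonneg_left h5 (by positivity : 0 ≤ 2 * p.lam)
  linarith

/-- The second moment of the number of customers grows at most linearly in time. -/
theorem exists_stoppedMean_sq_le (hlam : 0 < p.lam) (hmu : 0 < p.mu) {L : ℕ}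
    (hφ : ∀ y, φ y = false → y.1 ≤ L) :
    ∃ K, 0 ≤ K ∧ ∀ (z : State) (t : ℝ), 0 ≤ t → ∀ n,
      p.stoppedMean φ z t n (fun y => (y.1 : ℝ) ^ 2) ≤ (z.1 : ℝ) ^ 2 + K * t := by
  -- The generator applied to `i ^ 2` is at most `lam (2 L + 1)` when off. When on it is `lam + (2
  -- lam + mu) i - 2 mu i ^ 2`, and the second summand of `K` bounds the part depending on `i`.
  let K : ℝ := p.lam * (2 * L + 1) + (2 * p.lam + p.mu) ^ 2 / p.mu
  have hK : 0 ≤ K := by positivity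
  have hdrift : ∀ y : State, p.stepMean φ (fun y => (y.1 : ℝ) ^ 2) y - (y.1 : ℝ) ^ 2 ≤
      K * (p.rate φ y)⁻¹ := by
    intro y
    have hq := p.rate_pos φ hlam hmu y
    rw [stepMean_sub hlam hmu (fun y => (y.1 : ℝ) ^ 2), div_eq_mul_inv]
    refine mul_le_mul_of_nonneg_right ?_ (inv_pos.2 hq).le
    have hL : (0 : ℝ) ≤ L := Nat.cast_nonneg _
    have h0 : 0 ≤ (2 * p.lam + p.mu) ^ 2 / p.mu := by positivity
    cases hy : φ y
    · have : (y.1 : ℝ) ≤ L := by exact_mod_cast hφ y hy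
      simp only [departureRate, K, Bool.false_eq_true, if_false, Nat.cast_add, Nat.cast_one]
      nlinarith
    · simp only [departureRate, if_true, K]
      rcases y with ⟨_ | i, b⟩
      · simp
        nlinarith
      · simp only [Nat.cast_add, Nat.cast_one, add_tsub_cancel_right]
        have h1 : 0 ≤ p.lam * (2 * L) := by positivity
        have h2 : (2 * p.lam + p.mu) * (i + 1) ≤
            (2 * p.lam + p.mu) ^ 2 / p.mu + 2 * p.mu * (i + 1) ^ 2 := by
          rw [← sub_le_iff_le_add, le_div_iff₀ hmu]
          nlinarith [sq_nonneg (2 * p.lam + p.mu - p.mu * (i + 1)),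
            sq_nonneg (p.mu * ((i : ℝ) + 1))]
        nlinarith
  refine ⟨K, hK, fun z t ht n => ?_⟩
  rw [stoppedMean_eq hlam hmu z ht]
  refine add_le_add le_rfl ?_
  calc _ ≤ ∑ k ∈ Finset.range n, ∫ y, K * (p.rate φ y)⁻¹ ∂p.exited φ z t k :=
        Finset.sum_le_sum fun k _ =>
          integral_mono (integrable_exited _) (integrable_exited _) hdrift
    _ = K * p.stoppedTime φ z t n := by
        simp only [integral_const_mul, stoppedTime, Finset.mul_sum]
    _ ≤ K * t := mul_le_mul_of_nonneg_left (stoppedTime_le hlam hmu z ht n) hK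

end Params

/-! ### Expected cost and the Poisson equation -/

namespace Params

variable {p : Params} {φ : Policy}

/-- There are almost surely finitely many jumps in bounded time. -/
theorem ae_exists_lt_jumpTime (hlam : 0 < p.lam) (hmu : 0 < p.mu) (z : State) {t : ℝ}
    (ht : 0 ≤ t) : ∀ᵐ ω ∂noiseLaw, ∃ n, t < p.jumpTime φ z ω n := by
  -- Borel–Cantelli: the probabilities sum to the mean number of jumps up to `t`, which is finite.
  have h1 : ∑' k, noiseLaw {ω | p.jumpTime φ z ω (k + 1) ≤ t} ≠ ∞ := by
    refine ne_top_of_le_ne_top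
      (ENNReal.ofReal_ne_top (r := (z.1 : ℝ) + 2 * p.lam * t)) ?_
    rw [ENNReal.tsum_eq_iSup_nat]
    refine iSup_le fun n => ?_
    have h2 : ∀ k, noiseLaw {ω | p.jumpTime φ z ω (k + 1) ≤ t} =
        ENNReal.ofReal (∫ _, (1 : ℝ) ∂p.exited φ z t k) := by
      intro k
      rw [ofReal_integral_exited (f := fun _ => 1) fun _ => zero_le_one]
      simp
    simp only [h2]
    rw [← ENNReal.ofReal_sum_of_nonneg fun _ _ => integral_nonneg fun _ => zero_le_one]
    exact ENNReal.ofReal_le_ofReal (sum_exited_univ_le hlam hmu z ht n)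
  filter_upwards [ae_eventually_notMem h1] with ω hω
  obtain ⟨n, hn⟩ := hω.exists
  exact ⟨n + 1, by simpa using hn⟩

theorem lintegral_comp_stateAt (hlam : 0 < p.lam) (hmu : 0 < p.mu) (z : State) {t : ℝ}
    {ω : Noise} (hω : ∀ k, 0 ≤ (ω k).1) (hex : ∃ n, t < p.jumpTime φ z ω n)
    (F : State → ℝ≥0∞) :
    ∫⁻ s in Set.Icc 0 t, F (p.stateAt φ z ω s) =
      ∑' n, F (p.chain φ z ω n) *
        ENNReal.ofReal (min (p.jumpTime φ z ω (n + 1)) t - p.jumpTime φ z ω n) :=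
  lintegral_comp_sSup (p.monotone_jumpTime φ hlam hmu z hω) (p.jumpTime_zero φ z ω) hex
    fun n => F (p.chain φ z ω n)

variable (p φ)

/-- The cost per unit time in a state, under the action prescribed by the policy. -/
def runningCost (y : State) : ℝ := p.costRate y.1 (φ y)

/-- The switching cost incurred on entering a state, under the prescribed action. -/
def entryCost (y : State) : ℝ := p.switchCost y.2 (φ y)

variable {p φ}

/-- The expected cost during `[0,t]` as a sum over the jumps. -/
theorem lintegral_cumulativeCost (hlam : 0 < p.lam) (hmu : 0 < p.mu) (z : State) {t : ℝ}
    (ht : 0 ≤ t) (hr : ∀ y, 0 ≤ p.runningCost φ y) (hsw : ∀ y, 0 ≤ p.entryCost φ y) :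
    ∫⁻ ω, p.cumulativeCost φ z ω t ∂noiseLaw =
      ∑' n, ENNReal.ofReal (∫ y, p.entryCost φ y ∂p.entered φ z t n +
        ∫ y, p.runningCost φ y / p.rate φ y ∂p.exited φ z t n) := by
  have hrate : ∀ y, 0 ≤ p.runningCost φ y / p.rate φ y :=
    fun y => div_nonneg (hr y) (p.rate_pos φ hlam hmu y).le
  have hm1 : ∀ n, Measurable fun ω => ENNReal.ofReal (p.runningCost φ (p.chain φ z ω n)) *
      ENNReal.ofReal (min (p.jumpTime φ z ω (n + 1)) t - p.jumpTime φ z ω n) := fun n =>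
    ((measurable_of_countable fun y => ENNReal.ofReal (p.runningCost φ y)).comp
      (p.measurable_chain φ z n)).mul (measurable_sojourn z t n)
  have hm2 : ∀ n, Measurable ({ω | p.jumpTime φ z ω n ≤ t}.indicator
      fun ω => ENNReal.ofReal (p.entryCost φ (p.chain φ z ω n))) := fun n =>
    ((measurable_of_countable fun y => ENNReal.ofReal (p.entryCost φ y)).comp
      (p.measurable_chain φ z n)).indicator (p.measurableSet_jumpTime_le φ z t n)
  have h1 : ∀ᵐ ω ∂noiseLaw, p.cumulativeCost φ z ω t =
      (∑' n, ENNReal.ofReal (p.runningCost φ (p.chain φ z ω n)) *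
        ENNReal.ofReal (min (p.jumpTime φ z ω (n + 1)) t - p.jumpTime φ z ω n)) +
      ∑' n, {ω | p.jumpTime φ z ω n ≤ t}.indicator
        (fun ω => ENNReal.ofReal (p.entryCost φ (p.chain φ z ω n))) ω := by
    filter_upwards [ae_noise_nonneg, ae_exists_lt_jumpTime (φ := φ) hlam hmu z ht]
      with ω hω hex
    rw [cumulativeCost, ← lintegral_comp_stateAt hlam hmu z hω hex fun y =>
      ENNReal.ofReal (p.runningCost φ y)]
    rfl
  rw [lintegral_congr_ae h1, lintegral_add_left (Measurable.tsum hm1),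
    lintegral_tsum fun n => (hm1 n).aemeasurable, lintegral_tsum fun n => (hm2 n).aemeasurable,
    ← ENNReal.tsum_add]
  refine tsum_congr fun n => ?_
  rw [lintegral_reward hlam hmu z t n hr,
    lintegral_indicator (p.measurableSet_jumpTime_le φ z t n), ← ofReal_integral_entered hsw,
    ← ENNReal.ofReal_add (integral_nonneg hrate) (integral_nonneg hsw), add_comm]

/-- Without explosion the truncated sojourns fill `[0,t]` almost surely. -/
theorem tendsto_stoppedTime (hlam : 0 < p.lam) (hmu : 0 < p.mu) (z : State) {t : ℝ}
    (ht : 0 ≤ t) : Tendsto (p.stoppedTime φ z t) atTop (nhds t) := by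
  have h0 : ∀ k, 0 ≤ ∫ y, (p.rate φ y)⁻¹ ∂p.exited φ z t k := fun k =>
    integral_nonneg fun y => (inv_pos.2 (p.rate_pos φ hlam hmu y)).le
  have h1 : ∑' k, ENNReal.ofReal (∫ y, (p.rate φ y)⁻¹ ∂p.exited φ z t k) =
      ENNReal.ofReal t := by
    simp only [ofReal_integral_inv_rate hlam hmu]
    rw [← lintegral_tsum fun n => (measurable_sojourn z t n).aemeasurable]
    have h2 : ∀ᵐ ω ∂noiseLaw,
        ∑' n, ENNReal.ofReal (min (p.jumpTime φ z ω (n + 1)) t - p.jumpTime φ z ω n) =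
          ENNReal.ofReal t := by
      filter_upwards [ae_noise_nonneg, ae_exists_lt_jumpTime (φ := φ) hlam hmu z ht]
        with ω hω hex
      have := lintegral_comp_stateAt hlam hmu z hω hex fun _ => 1
      simpa using this.symm
    rw [lintegral_congr_ae h2]
    simp
  have h3 : Tendsto (fun n => ENNReal.ofReal (p.stoppedTime φ z t n)) atTop
      (nhds (ENNReal.ofReal t)) := by
    rw [← h1]
    simp only [stoppedTime, ENNReal.ofReal_sum_of_nonneg fun k _ => h0 k]
    exact ENNReal.tendsto_nat_tsum _
  have h4 := (ENNReal.tendsto_toReal ENNReal.ofReal_ne_top).comp h3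
  rw [ENNReal.toReal_ofReal ht] at h4
  refine h4.congr fun n => ?_
  simp [stoppedTime_nonneg hlam hmu]

variable (p φ)

/-- `w` is a relative value function with average cost `g` for the policy `φ`. -/
def IsRelativeValue (w : State → ℝ) (g : ℝ) : Prop :=
  ∀ y, w y = p.entryCost φ y + (p.runningCost φ y - g) / p.rate φ y + p.stepMean φ w y

/-- The expected cost up to time `t` or the `n`-th jump. -/
def stoppedCost (z : State) (t : ℝ) (n : ℕ) : ℝ :=
  ∑ k ∈ Finset.range n, (∫ y, p.entryCost φ y ∂p.entered φ z t k +
    ∫ y, p.runningCost φ y / p.rate φ y ∂p.exited φ z t k)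

variable {p φ}

/-- The Poisson equation is integrated over states that are left, whereas switching is charged on
entry. The last sum is this discrepancy: the switching cost of a state still occupied at time `t`.
-/
theorem stoppedCost_eq (hlam : 0 < p.lam) (hmu : 0 < p.mu) (z : State) {t : ℝ} (ht : 0 ≤ t)
    (n : ℕ) {w : State → ℝ} {g : ℝ} (hw : p.IsRelativeValue φ w g) :
    p.stoppedCost φ z t n = g * p.stoppedTime φ z t n + w z - p.stoppedMean φ z t n w +
      ∑ k ∈ Finset.range n, (∫ y, p.entryCost φ y ∂p.entered φ z t k -
        ∫ y, p.entryCost φ y ∂p.exited φ z t k) := by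
  have h1 : ∀ y, p.runningCost φ y / p.rate φ y =
      g * (p.rate φ y)⁻¹ - (p.stepMean φ w y - w y) - p.entryCost φ y := by
    intro y
    have := hw y
    rw [sub_div] at this
    rw [← div_eq_mul_inv]
    linarith
  rw [stoppedMean_eq hlam hmu z ht, stoppedCost, stoppedTime, Finset.mul_sum]
  simp only [h1]
  have h2 : ∀ k, ∫ y, (g * (p.rate φ y)⁻¹ - (p.stepMean φ w y - w y) - p.entryCost φ y)
      ∂p.exited φ z t k = g * ∫ y, (p.rate φ y)⁻¹ ∂p.exited φ z t k -
        ∫ y, (p.stepMean φ w y - w y) ∂p.exited φ z t k -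
        ∫ y, p.entryCost φ y ∂p.exited φ z t k := by
    intro k
    rw [integral_sub (integrable_exited _) (integrable_exited _),
      integral_sub (integrable_exited fun y => g * (p.rate φ y)⁻¹)
        (integrable_exited fun y => p.stepMean φ w y - w y), integral_const_mul]
  simp only [h2]
  rw [Finset.sum_add_distrib, Finset.sum_sub_distrib, Finset.sum_sub_distrib,
    Finset.sum_sub_distrib]
  ring

/-- Linear growth is absorbed by `B i ≤ B ^ 2 / (4 δ) + δ i ^ 2`, and the second moment grows at
rate at most `K`; `δ K ≤ ε` leaves an error of at most `ε t`, uniformly in `n`. -/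
theorem abs_stoppedCost_sub_le (hlam : 0 < p.lam) (hmu : 0 < p.mu) {L : ℕ}
    (hφ : ∀ y, φ y = false → y.1 ≤ L) (hsw : ∀ y, 0 ≤ p.entryCost φ y)
    {w : State → ℝ} {g : ℝ} (hw : p.IsRelativeValue φ w g) {A B : ℝ}
    (hAB : ∀ y, |w y| + p.entryCost φ y ≤ A + B * y.1) (z : State) {ε : ℝ} (hε : 0 < ε) :
    ∃ C, ∀ t, 0 ≤ t → ∀ n, |p.stoppedCost φ z t n - g * p.stoppedTime φ z t n| ≤ C + ε * t := by
  obtain ⟨K, hK, hsq⟩ := exists_stoppedMean_sq_le (φ := φ) hlam hmu hφ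
  obtain ⟨δ, hδ, hδK⟩ : ∃ δ > 0, δ * K ≤ ε := by
    refine ⟨ε / (K + 1), by positivity, ?_⟩
    rw [div_mul_eq_mul_div, div_le_iff₀ (by positivity)]
    nlinarith
  let A' := A + B ^ 2 / (4 * δ)
  refine ⟨|w z| + A' + δ * (z.1 : ℝ) ^ 2, fun t ht n => ?_⟩
  have hbound : p.stoppedMean φ z t n (fun y => |w y| + p.entryCost φ y) ≤
      A' + δ * ((z.1 : ℝ) ^ 2 + K * t) := by
    calc _ ≤ p.stoppedMean φ z t n (fun y => A' + δ * (y.1 : ℝ) ^ 2) := by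
          refine stoppedMean_mono hlam hmu z t n fun y => (hAB y).trans ?_
          have : B * y.1 ≤ B ^ 2 / (4 * δ) + δ * (y.1 : ℝ) ^ 2 := by
            rw [← sub_le_iff_le_add, le_div_iff₀ (by positivity)]
            nlinarith [sq_nonneg (B - 2 * δ * y.1)]
          simp only [A']
          linarith
      _ = A' + δ * p.stoppedMean φ z t n (fun y => (y.1 : ℝ) ^ 2) := by
          rw [stoppedMean_add, stoppedMean_const_mul, stoppedMean_const hlam hmu z ht]
      _ ≤ _ := by gcongr; exact hsq z t ht n
  rw [stoppedMean_add] at hbound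
  have h1 := stoppedMean_mono (φ := φ) hlam hmu z t n (fun y => le_abs_self (w y))
  have h2 : p.stoppedMean φ z t n (fun y => (-1) * w y) ≤ p.stoppedMean φ z t n fun y => |w y| :=
    stoppedMean_mono hlam hmu z t n fun y => by rw [neg_one_mul]; exact neg_le_abs _
  rw [stoppedMean_const_mul] at h2
  have h3 : 0 ≤ ∑ k ∈ Finset.range n, (∫ y, p.entryCost φ y ∂p.entered φ z t k -
      ∫ y, p.entryCost φ y ∂p.exited φ z t k) :=
    Finset.sum_nonneg fun k _ => sub_nonneg.2 (integral_exited_le hlam hmu z t k hsw)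
  have h4 : ∑ k ∈ Finset.range n, (∫ y, p.entryCost φ y ∂p.entered φ z t k -
      ∫ y, p.entryCost φ y ∂p.exited φ z t k) ≤ p.stoppedMean φ z t n (p.entryCost φ) :=
    le_add_of_nonneg_right (integral_nonneg hsw)
  have h5 : 0 ≤ p.stoppedMean φ z t n fun y => |w y| := by
    rw [← stoppedMean_const (φ := φ) hlam hmu z ht n 0]
    exact stoppedMean_mono hlam hmu z t n fun y => abs_nonneg _
  have h6 := mul_le_mul_of_nonneg_right hδK ht
  have h7 : p.stoppedMean φ z t n (fun y => p.entryCost φ y) =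
    p.stoppedMean φ z t n (p.entryCost φ) := rfl
  rw [h7] at hbound
  rw [stoppedCost_eq hlam hmu z ht n hw, abs_le]
  have := neg_abs_le (w z)
  have := le_abs_self (w z)
  constructor <;> linarith

/-- The average cost of a policy which serves whenever there are many customers is the constant in
its Poisson equation, provided that the relative value function grows at most linearly. -/
theorem averageCost_eq (hlam : 0 < p.lam) (hmu : 0 < p.mu) {L : ℕ}
    (hφ : ∀ y, φ y = false → y.1 ≤ L) (hr : ∀ y, 0 ≤ p.runningCost φ y)
    (hsw : ∀ y, 0 ≤ p.entryCost φ y) {w : State → ℝ} {g : ℝ}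
    (hw : p.IsRelativeValue φ w g) {A B : ℝ}
    (hAB : ∀ y, |w y| + p.entryCost φ y ≤ A + B * y.1) (z : State) :
    p.averageCost φ z = ENNReal.ofReal g := by
  have hterm : ∀ t k, 0 ≤ ∫ y, p.entryCost φ y ∂p.entered φ z t k +
      ∫ y, p.runningCost φ y / p.rate φ y ∂p.exited φ z t k := fun t k =>
    add_nonneg (integral_nonneg hsw)
      (integral_nonneg fun y => div_nonneg (hr y) (p.rate_pos φ hlam hmu y).le)
  have hlim : ∀ t, 0 ≤ t → Tendsto (fun n => ENNReal.ofReal (p.stoppedCost φ z t n)) atTop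
      (nhds (∫⁻ ω, p.cumulativeCost φ z ω t ∂noiseLaw)) := by
    intro t ht
    rw [lintegral_cumulativeCost hlam hmu z ht hr hsw]
    simp only [stoppedCost, ENNReal.ofReal_sum_of_nonneg fun k _ => hterm t k]
    exact ENNReal.tendsto_nat_tsum _
  -- For fixed `t`, let `n → ∞` in the uniform bound. Finiteness comes first, since `toReal` would
  -- send `∞` to `0`.
  have hbd : ∀ ε > 0, ∃ C, ∀ t, 0 ≤ t →
      (∫⁻ ω, p.cumulativeCost φ z ω t ∂noiseLaw) ≠ ∞ ∧
      |(∫⁻ ω, p.cumulativeCost φ z ω t ∂noiseLaw).toReal - g * t| ≤ C + ε * t := by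
    intro ε hε
    obtain ⟨C, hC⟩ := abs_stoppedCost_sub_le hlam hmu hφ hsw hw hAB z hε
    refine ⟨C, fun t ht => ?_⟩
    have hfin : (∫⁻ ω, p.cumulativeCost φ z ω t ∂noiseLaw) ≠ ∞ := by
      refine ne_top_of_le_ne_top (ENNReal.ofReal_ne_top (r := C + ε * t + |g| * t))
        (le_of_tendsto (hlim t ht) (Eventually.of_forall fun n => ENNReal.ofReal_le_ofReal ?_))
      have h1 := (abs_le.1 (hC t ht n)).2
      have h2 : g * p.stoppedTime φ z t n ≤ |g| * t :=
        mul_le_mul (le_abs_self g) (stoppedTime_le hlam hmu z ht n)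
          (stoppedTime_nonneg hlam hmu z t n) (abs_nonneg g)
      linarith
    refine ⟨hfin, ?_⟩
    have h1 : Tendsto (fun n => p.stoppedCost φ z t n) atTop
        (nhds (∫⁻ ω, p.cumulativeCost φ z ω t ∂noiseLaw).toReal) := by
      refine ((ENNReal.tendsto_toReal hfin).comp (hlim t ht)).congr fun n => ?_
      exact ENNReal.toReal_ofReal (Finset.sum_nonneg fun k _ => hterm t k)
    have h2 := (h1.sub ((tendsto_stoppedTime (φ := φ) hlam hmu z ht).const_mul g)).abs
    exact le_of_tendsto h2 (Eventually.of_forall (hC t ht))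
  have hreal : Tendsto (fun t : ℝ => (∫⁻ ω, p.cumulativeCost φ z ω t ∂noiseLaw).toReal / t)
      atTop (nhds g) := by
    rw [Metric.tendsto_atTop]
    intro ε hε
    obtain ⟨C, hC⟩ := hbd (ε / 2) (by positivity)
    refine ⟨max 1 (2 * (|C| + 1) / ε), fun t ht => ?_⟩
    have ht1 : 1 ≤ t := (le_max_left _ _).trans ht
    have ht0 : 0 < t := by linarith
    have ht2 : 2 * (|C| + 1) ≤ t * ε := (div_le_iff₀ hε).1 ((le_max_right _ _).trans ht)
    have h1 := (hC t ht0.le).2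
    rw [Real.dist_eq, div_sub' ht0.ne', abs_div, abs_of_pos ht0, div_lt_iff₀ ht0, mul_comm t g]
    have := le_abs_self C
    linarith
  have hfinal : Tendsto (fun t : ℝ => (∫⁻ ω, p.cumulativeCost φ z ω t ∂noiseLaw) /
      ENNReal.ofReal t) atTop (nhds (ENNReal.ofReal g)) := by
    refine (ENNReal.tendsto_ofReal hreal).congr' ?_
    filter_upwards [eventually_gt_atTop 0] with t ht
    obtain ⟨C, hC⟩ := hbd 1 one_pos
    rw [ENNReal.ofReal_div_of_pos ht, ENNReal.ofReal_toReal (hC t ht.le).1]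
  exact hfinal.limsup_eq

end Params

/-! ### Descent times of the running queue -/

/-- The expected number of arrivals while the number of customers of a running `M/M/∞` queue with
offered load `ρ` first decreases from `k + 1` to `k`. -/
def descentLoad (ρ : ℝ) (k : ℕ) : ℝ :=
  ∑' j : ℕ, ρ ^ (j + 1) / ((k + 1).ascFactorial (j + 1) : ℝ)

theorem ascFactorial_cast_pos (k j : ℕ) : (0 : ℝ) < ((k + 1).ascFactorial j : ℝ) := by
  exact_mod_cast Nat.ascFactorial_pos k j

theorem summable_descentLoad {ρ : ℝ} (hρ : 0 < ρ) (k : ℕ) :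
    Summable fun j : ℕ => ρ ^ (j + 1) / ((k + 1).ascFactorial (j + 1) : ℝ) := by
  have h := (summable_nat_add_iff 1).2 (Real.summable_pow_div_factorial ρ)
  refine Summable.of_nonneg_of_le
    (fun j => div_nonneg (pow_nonneg hρ.le _) (Nat.cast_nonneg _)) (fun j => ?_) h
  refine div_le_div_of_nonneg_left (pow_nonneg hρ.le _) (by positivity) ?_
  have h1 : (1 : ℕ).ascFactorial (j + 1) ≤ (k + 1).ascFactorial (j + 1) := by
    induction j with
    | zero => simp [Nat.ascFactorial_succ]
    | succ j ih =>
      rw [Nat.ascFactorial_succ, Nat.ascFactorial_succ (n := k + 1)]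
      gcongr
      omega
  rw [Nat.one_ascFactorial] at h1
  exact_mod_cast h1

/-- Every term after the first contains the factor `ρ / (k + 1)`, and what remains is the series for
`k + 1`. Probabilistically this is first-step analysis. -/
theorem succ_mul_descentLoad {ρ : ℝ} (hρ : 0 < ρ) (k : ℕ) :
    (k + 1) * descentLoad ρ k = ρ * (1 + descentLoad ρ (k + 1)) := by
  have hk : (k : ℝ) + 1 ≠ 0 := by positivity
  have h1 : ∀ j : ℕ, ρ ^ (j + 1 + 1) / ((k + 1).ascFactorial (j + 1 + 1) : ℝ) =
      ρ / (k + 1) * (ρ ^ (j + 1) / ((k + 1 + 1).ascFactorial (j + 1) : ℝ)) := by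
    intro j
    have h2 : ((k + 1).ascFactorial (j + 1 + 1) : ℝ) =
        (k + 1) * ((k + 1 + 1).ascFactorial (j + 1) : ℝ) := by
      have := Nat.succ_ascFactorial (k + 1) (j + 1)
      rw [Nat.ascFactorial_succ, ← this]
      push_cast
      simp
    rw [h2, pow_succ ρ (j + 1)]
    have := (ascFactorial_cast_pos (k + 1) (j + 1)).ne'
    field_simp
  rw [descentLoad, (summable_descentLoad hρ k).tsum_eq_zero_add]
  simp only [h1]
  rw [tsum_mul_left, ← descentLoad]
  simp only [zero_add, pow_one, Nat.ascFactorial_succ, Nat.ascFactorial_zero]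
  push_cast
  field_simp
  ring

theorem descentLoad_pos {ρ : ℝ} (hρ : 0 < ρ) (k : ℕ) : 0 < descentLoad ρ k :=
  (summable_descentLoad hρ k).tsum_pos
    (fun _ => div_nonneg (pow_nonneg hρ.le _) (Nat.cast_nonneg _)) 0 (div_pos (pow_pos hρ _) (ascFactorial_cast_pos k _))

theorem strictAnti_descentLoad {ρ : ℝ} (hρ : 0 < ρ) : StrictAnti (descentLoad ρ) := by
  refine strictAnti_nat_of_succ_lt fun k => ?_
  have hlt : ∀ j : ℕ, (k + 1).ascFactorial (j + 1) < (k + 1 + 1).ascFactorial (j + 1) := by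
    intro j
    induction j with
    | zero => simp [Nat.ascFactorial_succ]
    | succ j ih =>
      rw [Nat.ascFactorial_succ, Nat.ascFactorial_succ (n := k + 1 + 1)]
      exact Nat.mul_lt_mul'' (by omega) ih
  have h : ∀ j : ℕ, ρ ^ (j + 1) / ((k + 1 + 1).ascFactorial (j + 1) : ℝ) <
      ρ ^ (j + 1) / ((k + 1).ascFactorial (j + 1) : ℝ) := fun j =>
    div_lt_div_of_pos_left (pow_pos hρ _) (ascFactorial_cast_pos k _) (by exact_mod_cast hlt j)
  exact Summable.tsum_lt_tsum (i := 0) (fun j => (h j).le) (h 0)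
    (summable_descentLoad hρ (k + 1)) (summable_descentLoad hρ k)

/-- The expected number of arrivals while a running `M/M/∞` queue empties from `N` customers. -/
def busyLoad (ρ : ℝ) (N : ℕ) : ℝ := ∑ k ∈ Finset.range N, descentLoad ρ k

theorem busyLoad_succ (ρ : ℝ) (N : ℕ) :
    busyLoad ρ (N + 1) = busyLoad ρ N + descentLoad ρ N := Finset.sum_range_succ _ _

theorem busyLoad_nonneg {ρ : ℝ} (hρ : 0 < ρ) (N : ℕ) : 0 ≤ busyLoad ρ N :=
  Finset.sum_nonneg fun k _ => (descentLoad_pos hρ k).le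

theorem busyLoad_le {ρ : ℝ} (hρ : 0 < ρ) (N : ℕ) : busyLoad ρ N ≤ N * descentLoad ρ 0 := by
  have := Finset.sum_le_sum (s := Finset.range N) fun k _ =>
    (strictAnti_descentLoad hρ).antitone (Nat.zero_le k)
  simpa [busyLoad] using this

/-- `busyLoad ρ N` has `N` terms, each exceeding `descentLoad ρ N`; strictness needs at least one
term. -/
theorem mul_descentLoad_lt_busyLoad {ρ : ℝ} (hρ : 0 < ρ) {N : ℕ} (hN : 1 ≤ N) :
    N * descentLoad ρ N < busyLoad ρ N := by
  have := Finset.sum_lt_sum_of_nonempty (s := Finset.range N) (by simpa using by omega) fun k hk =>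
    strictAnti_descentLoad hρ (Finset.mem_range.1 hk)
  simpa [busyLoad] using this

/-! ### The relative value function of the `(0,N)`-policy -/

namespace Params

variable (p : Params)

/-- The offered load. -/
def load : ℝ := p.lam / p.mu

/-- The expected cost per cycle of the `(0,N)`-policy, up to the factor `1 / lam` and the
holding cost of the stationary `M/M/∞` queue. -/
def cycleCost (N : ℕ) : ℝ :=
  p.lam * (p.s₀ + p.s₁) + p.h * (N * (N - 1) / 2) + p.c * busyLoad p.load N

/-- The average cost of the `(0,N)`-policy. -/
def thresholdCost (N : ℕ) : ℝ :=
  p.h * p.load + p.cycleCost N / (N + busyLoad p.load N)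

/-- The relative value of a running system with `i` customers. -/
def valueOn (g : ℝ) (i : ℕ) : ℝ :=
  p.h / p.mu * i + (p.c + p.h * p.load - g) / p.lam * busyLoad p.load i

/-- The relative value of an idling system with `i` customers. -/
def valueOff (g : ℝ) (i : ℕ) : ℝ := -p.s₀ + (g * i - p.h * (i * (i - 1) / 2)) / p.lam

/-- The relative value function of the `(0,N)`-policy. -/
def value (N : ℕ) (y : State) : ℝ :=
  p.entryCost (thresholdPolicy 0 N) y +
    if thresholdPolicy 0 N y then p.valueOn (p.thresholdCost N) y.1
    else p.valueOff (p.thresholdCost N) y.1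

variable {p}

theorem load_pos (hlam : 0 < p.lam) (hmu : 0 < p.mu) : 0 < p.load := div_pos hlam hmu

theorem cycle_pos (hlam : 0 < p.lam) (hmu : 0 < p.mu) {N : ℕ} (hN : 1 ≤ N) :
    0 < (N : ℝ) + busyLoad p.load N := by
  have h1 := busyLoad_nonneg (load_pos hlam hmu) N
  have h2 : (1 : ℝ) ≤ N := by exact_mod_cast hN
  linarith

/-- This matching condition at the switch-on level determines the average cost: it is equivalent to
`(g - h ρ) (N + B N) = cycleCost N`. -/
theorem valueOff_threshold (hlam : 0 < p.lam) (hmu : 0 < p.mu) {N : ℕ} (hN : 1 ≤ N) :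
    p.valueOff (p.thresholdCost N) N = p.s₁ + p.valueOn (p.thresholdCost N) N := by
  have hD := cycle_pos hlam hmu hN
  have hg : (p.thresholdCost N - p.h * p.load) * (N + busyLoad p.load N) = p.cycleCost N := by
    rw [thresholdCost, add_sub_cancel_left, div_mul_cancel₀ _ hD.ne']
  generalize p.thresholdCost N = g at hg ⊢
  have hl : p.h / p.mu = p.h * p.load / p.lam := by rw [load]; field_simp
  rw [valueOff, valueOn, hl]
  rw [cycleCost] at hg
  field_simp
  linarith

/-- At `i = 0` the system is switched off, and the shut-down cost cancels the constant `-s₀` in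
`valueOff`. -/
theorem value_on (N : ℕ) (i : ℕ) :
    p.value N (i, true) = p.valueOn (p.thresholdCost N) i := by
  rcases i with _ | i
  · simp [value, thresholdPolicy, entryCost, switchCost, valueOff, valueOn, busyLoad]
  · simp [value, thresholdPolicy, entryCost, switchCost]

theorem value_off (hlam : 0 < p.lam) (hmu : 0 < p.mu) {N : ℕ} (hN : 1 ≤ N) {i : ℕ}
    (hi : i ≤ N) : p.value N (i, false) = p.valueOff (p.thresholdCost N) i := by
  rcases hi.lt_or_eq with h | rfl
  · simp [value, thresholdPolicy, entryCost, switchCost, h.not_ge]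
  · rw [valueOff_threshold hlam hmu hN]
    simp [value, thresholdPolicy, entryCost, switchCost]

theorem lt_of_thresholdPolicy_eq_false {N : ℕ} (hN : 1 ≤ N) {y : State}
    (hy : thresholdPolicy 0 N y = false) : y.1 < N := by
  rcases y with ⟨i, _ | _⟩ <;> simp [thresholdPolicy] at hy <;> simp only <;> omega

theorem pos_of_thresholdPolicy_eq_true {N : ℕ} (hN : 1 ≤ N) {y : State}
    (hy : thresholdPolicy 0 N y = true) : 0 < y.1 := by
  rcases y with ⟨i, _ | _⟩ <;> simp [thresholdPolicy] at hy <;> simp only <;> omega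

theorem isRelativeValue_value (hlam : 0 < p.lam) (hmu : 0 < p.mu) {N : ℕ} (hN : 1 ≤ N) :
    p.IsRelativeValue (thresholdPolicy 0 N) (p.value N) (p.thresholdCost N) := by
  intro y
  have hq := p.rate_pos (thresholdPolicy 0 N) hlam hmu y
  -- The entry cost cancels. The next state carries the status just chosen, so only one of the two
  -- branches of the value function is involved.
  rw [value, stepMean, add_assoc, add_right_inj]
  cases hy : thresholdPolicy 0 N y
  · have hi := lt_of_thresholdPolicy_eq_false hN hy
    have hrate : p.rate (thresholdPolicy 0 N) y = p.lam := by
      simp [rate, exitRate, departureRate, hy]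
    rw [value_off hlam hmu hN hi, hrate, runningCost, hy]
    simp only [costRate, valueOff, Bool.false_eq_true, if_false]
    push_cast
    field_simp
    ring
  · have hi := pos_of_thresholdPolicy_eq_true hN hy
    obtain ⟨i, hi⟩ : ∃ i, y.1 = i + 1 := ⟨y.1 - 1, by omega⟩
    have hrate : p.rate (thresholdPolicy 0 N) y = p.lam + (i + 1) * p.mu := by
      simp [rate, exitRate, departureRate, hy, hi]
    rw [hrate] at hq
    rw [value_on, value_on, hrate, runningCost, hy, hi]
    simp only [costRate, valueOn, if_true, add_tsub_cancel_right, busyLoad_succ]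
    have hrec := succ_mul_descentLoad (load_pos hlam hmu) i
    generalize p.thresholdCost N = g
    have hS : descentLoad p.load (i + 1) = (i + 1) * descentLoad p.load i * p.mu / p.lam - 1 := by
      rw [hrec, load]
      field_simp
      ring
    rw [hS, load]
    push_cast
    field_simp
    ring

theorem entryCost_nonneg (hs₀ : 0 ≤ p.s₀) (hs₁ : 0 ≤ p.s₁) (φ : Policy) (y : State) :
    0 ≤ p.entryCost φ y := by
  unfold entryCost switchCost
  split_ifs <;> simp [*]

theorem entryCost_le (hs₀ : 0 ≤ p.s₀) (hs₁ : 0 ≤ p.s₁) (φ : Policy) (y : State) :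
    p.entryCost φ y ≤ p.s₀ + p.s₁ := by
  unfold entryCost switchCost
  split_ifs <;> linarith

theorem runningCost_nonneg (hh : 0 < p.h) (hc : 0 ≤ p.c) (φ : Policy) (y : State) :
    0 ≤ p.runningCost φ y := by
  unfold runningCost costRate
  split_ifs <;> positivity

/-- The idling branch occurs only for fewer than `N` customers, and `busyLoad` is at most linear. -/
theorem exists_value_le (hlam : 0 < p.lam) (hmu : 0 < p.mu) (hs₀ : 0 ≤ p.s₀) (hs₁ : 0 ≤ p.s₁)
    {N : ℕ} (hN : 1 ≤ N) : ∃ A B : ℝ, ∀ y,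
      |p.value N y| + p.entryCost (thresholdPolicy 0 N) y ≤ A + B * y.1 := by
  let g := p.thresholdCost N
  let κ := (p.c + p.h * p.load - g) / p.lam
  let O := ∑ k ∈ Finset.range N, |p.valueOff g k|
  let B := |p.h / p.mu| + |κ| * descentLoad p.load 0
  have hρ := load_pos hlam hmu
  have hO : 0 ≤ O := Finset.sum_nonneg fun _ _ => abs_nonneg _
  have hB : 0 ≤ B := add_nonneg (abs_nonneg _)
    (mul_nonneg (abs_nonneg _) (descentLoad_pos hρ 0).le)
  refine ⟨2 * (p.s₀ + p.s₁) + O, B, fun y => ?_⟩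
  have he0 := entryCost_nonneg hs₀ hs₁ (thresholdPolicy 0 N) y
  have he1 := entryCost_le hs₀ hs₁ (thresholdPolicy 0 N) y
  have hyB : 0 ≤ B * y.1 := mul_nonneg hB (Nat.cast_nonneg _)
  have hv : |if thresholdPolicy 0 N y then p.valueOn g y.1 else p.valueOff g y.1| ≤
      O + B * y.1 := by
    cases hy : thresholdPolicy 0 N y
    · have := Finset.single_le_sum (f := fun k => |p.valueOff g k|)
        (fun _ _ => abs_nonneg _) (Finset.mem_range.2 (lt_of_thresholdPolicy_eq_false hN hy))
      simp only [Bool.false_eq_true, if_false]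
      linarith
    · simp only [if_true, valueOn]
      have h1 := abs_add_le (p.h / p.mu * y.1) (κ * busyLoad p.load y.1)
      rw [abs_mul, abs_mul, Nat.abs_cast, abs_of_nonneg (busyLoad_nonneg hρ _)] at h1
      have h2 := mul_le_mul_of_nonneg_left (busyLoad_le hρ y.1) (abs_nonneg κ)
      have h3 : B * y.1 = |p.h / p.mu| * y.1 + |κ| * (y.1 * descentLoad p.load 0) := by
        simp only [B]; ring
      linarith
  have h4 := abs_add_le (p.entryCost (thresholdPolicy 0 N) y)
    (if thresholdPolicy 0 N y then p.valueOn g y.1 else p.valueOff g y.1)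
  rw [abs_of_nonneg he0] at h4
  rw [value]
  linarith

/-- The average cost of the `(0,N)`-policy, from any initial state. -/
theorem averageCost_thresholdPolicy (hlam : 0 < p.lam) (hmu : 0 < p.mu) (hh : 0 < p.h)
    (hc : 0 ≤ p.c) (hs₀ : 0 ≤ p.s₀) (hs₁ : 0 ≤ p.s₁) {N : ℕ} (hN : 1 ≤ N) (z : State) :
    p.averageCost (thresholdPolicy 0 N) z = ENNReal.ofReal (p.thresholdCost N) := by
  obtain ⟨A, B, hAB⟩ := exists_value_le hlam hmu hs₀ hs₁ hN
  exact averageCost_eq hlam hmu (L := N)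
    (fun y hy => (lt_of_thresholdPolicy_eq_false hN hy).le) (runningCost_nonneg hh hc _)
    (entryCost_nonneg hs₀ hs₁ _) (isRelativeValue_value hlam hmu hN) hAB z

/-! ### Comparing consecutive thresholds -/

theorem thresholdCost_pos (hlam : 0 < p.lam) (hmu : 0 < p.mu) (hh : 0 < p.h) (hc : 0 ≤ p.c)
    (hs₀ : 0 ≤ p.s₀) (hs₁ : 0 ≤ p.s₁) {N : ℕ} (hN : 1 ≤ N) : 0 < p.thresholdCost N := by
  have h1 := load_pos hlam hmu
  have h2 := busyLoad_nonneg h1 N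
  have h3 := cycle_pos hlam hmu hN
  have h4 : (0 : ℝ) ≤ N - 1 := sub_nonneg.2 (by exact_mod_cast hN)
  have : 0 ≤ p.cycleCost N := by unfold cycleCost; positivity
  unfold thresholdCost
  positivity

/-- From `N` to `N + 1` the cycle cost grows by `h N + c S N` and the denominator by `1 + S N`. The
cross-multiplied difference is grouped so that each condition defining `Ntilde` controls one
summand. -/
theorem thresholdCost_succ_sub (hlam : 0 < p.lam) (hmu : 0 < p.mu) {N : ℕ} (hN : 1 ≤ N) :
    p.thresholdCost (N + 1) - p.thresholdCost N =
      ((1 + descentLoad p.load N) * (p.h * (N * (N + 1) / 2) - p.lam * (p.s₀ + p.s₁)) +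
        (p.h * N - p.c) * (busyLoad p.load N - N * descentLoad p.load N)) /
      ((N + busyLoad p.load N) * ((N + 1 : ℕ) + busyLoad p.load (N + 1))) := by
  have h1 := (cycle_pos hlam hmu hN).ne'
  have h2 := (cycle_pos hlam hmu (Nat.le_add_left 1 N)).ne'
  rw [thresholdCost, thresholdCost, add_sub_add_left_eq_sub, div_sub_div _ _ h2 h1,
    mul_comm ((N : ℝ) + busyLoad p.load N)]
  congr 1
  simp only [cycleCost, busyLoad_succ]
  push_cast
  ring

theorem Ntilde_pos (hlam : 0 < p.lam) (hh : 0 < p.h) (hs : 0 < p.s₀ + p.s₁) :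
    1 ≤ p.Ntilde := by
  by_contra h
  have h1 := (p.isLeast_Ntilde hlam).1.2
  rw [show p.Ntilde = 0 by omega] at h1
  have := div_pos hs hh
  simp at h1
  linarith

theorem le_of_Ntilde_le (hlam : 0 < p.lam) (hh : 0 < p.h) {N : ℕ} (hN : p.Ntilde ≤ N) :
    p.c ≤ p.h * N ∧ p.lam * (p.s₀ + p.s₁) ≤ p.h * (N * (N + 1) / 2) := by
  obtain ⟨h1, h2⟩ := (p.isLeast_Ntilde hlam).1
  have hN' : (p.Ntilde : ℝ) ≤ N := by exact_mod_cast hN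
  constructor
  · rw [div_le_iff₀ hh] at h1
    nlinarith
  · have h3 : (p.s₀ + p.s₁) / p.h ≤ N * (N + 1) / (2 * p.lam) := by
      refine h2.trans ?_
      gcongr
    rw [div_le_div_iff₀ hh (by positivity)] at h3
    linarith

theorem critical_iff (hlam : 0 < p.lam) (hh : 0 < p.h) {N : ℕ} :
    ((N : ℝ) = p.c / p.h ∧ (N : ℝ) * (N + 1) / (2 * p.lam) = (p.s₀ + p.s₁) / p.h) ↔
      p.h * N - p.c = 0 ∧ p.h * (N * (N + 1) / 2) - p.lam * (p.s₀ + p.s₁) = 0 := by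
  refine and_congr ?_ ?_
  · rw [eq_div_iff hh.ne', sub_eq_zero, mul_comm]
  · rw [div_eq_div_iff (by positivity) hh.ne']
    constructor <;> intro h <;> linarith

theorem thresholdCost_lt_succ (hlam : 0 < p.lam) (hmu : 0 < p.mu) (hh : 0 < p.h)
    (hs : 0 < p.s₀ + p.s₁) {N : ℕ} (hN : p.Ntilde ≤ N)
    (hne : ¬ ((N : ℝ) = p.c / p.h ∧
      (N : ℝ) * (N + 1) / (2 * p.lam) = (p.s₀ + p.s₁) / p.h)) :
    p.thresholdCost N < p.thresholdCost (N + 1) := by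
  have hN1 : 1 ≤ N := (Ntilde_pos hlam hh hs).trans hN
  have hρ := load_pos hlam hmu
  obtain ⟨h1, h2⟩ := le_of_Ntilde_le hlam hh hN
  rw [critical_iff hlam hh] at hne
  rw [← sub_pos, thresholdCost_succ_sub hlam hmu hN1]
  refine div_pos ?_ (mul_pos (cycle_pos hlam hmu hN1) (cycle_pos hlam hmu (Nat.le_add_left 1 N)))
  have h3 : 0 < 1 + descentLoad p.load N := by linarith [descentLoad_pos hρ N]
  have h4 := sub_pos.2 (mul_descentLoad_lt_busyLoad hρ hN1)
  -- Outside the exceptional case at least one of the two nonnegative brackets is positive, and its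
  -- cofactor is positive.
  rcases (sub_nonneg.2 h1).eq_or_lt with h5 | h5
  · have h6 := lt_of_le_of_ne (sub_nonneg.2 h2) fun h => hne ⟨h5.symm, h.symm⟩
    exact add_pos_of_pos_of_nonneg (mul_pos h3 h6) (mul_nonneg h5.le h4.le)
  · exact add_pos_of_nonneg_of_pos (mul_nonneg h3.le (sub_nonneg.2 h2)) (mul_pos h5 h4)

theorem thresholdCost_eq_succ (hlam : 0 < p.lam) (hmu : 0 < p.mu) (hh : 0 < p.h)
    {N : ℕ} (hN : 1 ≤ N)
    (heq : (N : ℝ) = p.c / p.h ∧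
      (N : ℝ) * (N + 1) / (2 * p.lam) = (p.s₀ + p.s₁) / p.h) :
    p.thresholdCost N = p.thresholdCost (N + 1) := by
  rw [critical_iff hlam hh] at heq
  rw [eq_comm, ← sub_eq_zero, thresholdCost_succ_sub hlam hmu hN, heq.1, heq.2]
  simp

end Params

end

end SwitchQueue

/-! ### The main theorem -/

theorem theorem6 (p : SwitchQueue.Params)
    (hlam : 0 < p.lam) (hmu : 0 < p.mu) (hh : 0 < p.h) (hc : 0 ≤ p.c)
    (hs₀ : 0 ≤ p.s₀) (hs₁ : 0 ≤ p.s₁) (hs : 0 < p.s₀ + p.s₁)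
    (z : SwitchQueue.State) :
    (∀ N : ℕ, p.Ntilde ≤ N →
      ¬ ((N : ℝ) = p.c / p.h ∧ (N : ℝ) * (N + 1) / (2 * p.lam) = (p.s₀ + p.s₁) / p.h) →
      p.averageCost (SwitchQueue.thresholdPolicy 0 N) z < p.averageCost (SwitchQueue.thresholdPolicy 0 (N + 1)) z) ∧
    (∀ N : ℕ, p.Ntilde ≤ N →
      ((N : ℝ) = p.c / p.h ∧ (N : ℝ) * (N + 1) / (2 * p.lam) = (p.s₀ + p.s₁) / p.h) →
      p.averageCost (SwitchQueue.thresholdPolicy 0 N) z = p.averageCost (SwitchQueue.thresholdPolicy 0 (N + 1)) z) ∧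
    IsLeast ((fun N : ℕ => p.averageCost (SwitchQueue.thresholdPolicy 0 N) z) '' Set.Icc 1 p.Ntilde)
      (⨅ (N : ℕ) (_ : 1 ≤ N), p.averageCost (SwitchQueue.thresholdPolicy 0 N) z) := by
  have hpos : 1 ≤ p.Ntilde := SwitchQueue.Params.Ntilde_pos hlam hh hs
  have hcost : ∀ N : ℕ, 1 ≤ N → p.averageCost (SwitchQueue.thresholdPolicy 0 N) z =
      ENNReal.ofReal (p.thresholdCost N) := fun N hN =>
    SwitchQueue.Params.averageCost_thresholdPolicy hlam hmu hh hc hs₀ hs₁ hN z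
  have hlt : ∀ N : ℕ, p.Ntilde ≤ N →
      ¬ ((N : ℝ) = p.c / p.h ∧ (N : ℝ) * (N + 1) / (2 * p.lam) = (p.s₀ + p.s₁) / p.h) →
      p.averageCost (SwitchQueue.thresholdPolicy 0 N) z <
        p.averageCost (SwitchQueue.thresholdPolicy 0 (N + 1)) z := by
    intro N hN hne
    rw [hcost N (hpos.trans hN), hcost (N + 1) (by omega), ENNReal.ofReal_lt_ofReal_iff
      (SwitchQueue.Params.thresholdCost_pos hlam hmu hh hc hs₀ hs₁ (by omega))]
    exact SwitchQueue.Params.thresholdCost_lt_succ hlam hmu hh hs hN hne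
  have heq : ∀ N : ℕ, p.Ntilde ≤ N →
      ((N : ℝ) = p.c / p.h ∧ (N : ℝ) * (N + 1) / (2 * p.lam) = (p.s₀ + p.s₁) / p.h) →
      p.averageCost (SwitchQueue.thresholdPolicy 0 N) z =
        p.averageCost (SwitchQueue.thresholdPolicy 0 (N + 1)) z := by
    intro N hN he
    rw [hcost N (hpos.trans hN), hcost (N + 1) (by omega),
      SwitchQueue.Params.thresholdCost_eq_succ hlam hmu hh (hpos.trans hN) he]
  refine ⟨hlt, heq, ?_⟩
  have hmono : ∀ N : ℕ, p.Ntilde ≤ N →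
      p.averageCost (SwitchQueue.thresholdPolicy 0 p.Ntilde) z ≤
        p.averageCost (SwitchQueue.thresholdPolicy 0 N) z := by
    intro N hN
    induction N, hN using Nat.le_induction with
    | base => exact le_rfl
    | succ N hN ih =>
      by_cases he : (N : ℝ) = p.c / p.h ∧
          (N : ℝ) * (N + 1) / (2 * p.lam) = (p.s₀ + p.s₁) / p.h
      · exact ih.trans (heq N hN he).le
      · exact ih.trans (hlt N hN he).le
  -- A minimiser over the finite range is a global one, since beyond `Ntilde` no cost falls below
  -- the cost at `Ntilde`.
  obtain ⟨M, hM, hmin⟩ := Set.exists_min_image (Set.Icc 1 p.Ntilde)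
    (fun N : ℕ => p.averageCost (SwitchQueue.thresholdPolicy 0 N) z) (Set.finite_Icc _ _)
    ⟨p.Ntilde, hpos, le_rfl⟩
  have hinf : ⨅ (N : ℕ) (_ : 1 ≤ N), p.averageCost (SwitchQueue.thresholdPolicy 0 N) z =
      p.averageCost (SwitchQueue.thresholdPolicy 0 M) z := by
    refine le_antisymm (iInf₂_le M hM.1) (le_iInf₂ fun N hN => ?_)
    rcases le_total N p.Ntilde with h | h
    · exact hmin N ⟨hN, h⟩
    · exact (hmin p.Ntilde ⟨hpos, le_rfl⟩).trans (hmono N h)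
  refine ⟨⟨M, hM, hinf.symm⟩, ?_⟩
  rintro _ ⟨N, hN, rfl⟩
  exact iInf₂_le N hN.1
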